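/- Let $a>0$ be a real number. The Buckley--Osthus random multigraph $H_{a,1}^n$ with vertices $1,\dots,n$ is built inductively from the empty graph $H_{a,1}^0$: for $t=1,\dots,n$, given $H_{a,1}^{t-1}$, add the vertex $t$ and one edge from $t$ to a random vertex $i\in\{1,\dots,t\}$, where $i=s$ has (conditional) probability $\frac{d(s)-1+a}{(a+1)t-1}$ for $1\le s\le t-1$ and $\frac{a}{(a+1)t-1}$ for $s=t$ (a loop); here $d(s)$ is the degree of $s$ in $H_{a,1}^{t-1}$, a loop counting twice. The second degree of a vertex $t$ is the number of edges that are not incident to $t$ but have an endpoint adjacent to $t$. Let $X_n(k)$ be the number of vertices of $H_{a,1}^n$ whose second degree is exactly $k$. Then there is a constant $C>0$, depending only on $a$, such that for all integers $n\ge 1$ and $k\ge 1$ $$ \mathsf{E}\,X_n(k)=\frac{(a+1)\,\Gamma(2a+1)\,n}{\Gamma(a)\,k^{a+1}}\,\bigl(1+\varepsilon_1+\varepsilon_2\bigr) $$ for some real $\varepsilon_1=\varepsilon_1(n,k)$, $\varepsilon_2=\varepsilon_2(n,k)$ with $$ |\varepsilon_1|\le C\,\frac{(\ln \max(k,2))^{\lceil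 a+1\rceil}}{k},\qquad |\varepsilon_2|\le C\,\frac{k^{1+a}}{n}. $$ -/

import Mathlib

/-- The multigraphs with vertex set `Fin n` that the process can produce: there is one edge for every
vertex `i`, and it joins `i` to `f i`; the edge of `i` is a loop when `f i = i`.  Vertices are
numbered from `0`, so that `i : Fin n` stands for the `(i + 1)`-st vertex. -/
abbrev EdgeMap (n : ℕ) : Type := Fin n → Fin n

namespace EdgeMap

/-- The pair of endpoints of the edge that was added together with the vertex `i`. -/
def edge {n : ℕ} (f : EdgeMap n) (i : Fin n) : Sym2 (Fin n) := s(i, f i)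

/-- The degree of the vertex `s`: the number of ends of edges at `s`, a loop counting twice. -/
def degree {n : ℕ} (f : EdgeMap n) (s : Fin n) : ℕ :=
  ∑ i : Fin n, ((if i = s then 1 else 0) + (if f i = s then 1 else 0))

open Classical in
/-- The second degree of the vertex `t`: the number of edges that are not incident to `t` and have
an endpoint which is a neighbour of `t`. -/
noncomputable def secondDegree {n : ℕ} (f : EdgeMap n) (t : Fin n) : ℕ :=
  (Finset.univ.filter fun i : Fin n =>
    t ∉ f.edge i ∧ ∃ u ∈ f.edge i, ∃ j : Fin n, f.edge j = s(t, u)).card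

/-- The number of vertices whose second degree is exactly `k`. -/
noncomputable def countSecondDegree {n : ℕ} (f : EdgeMap n) (k : ℕ) : ℕ :=
  (Finset.univ.filter fun t : Fin n => f.secondDegree t = k).card

/-- Add one more vertex (the last one), together with an edge from it to the vertex `s`, which may
be the new vertex itself. -/
def extend {n : ℕ} (f : EdgeMap n) (s : Fin (n + 1)) : EdgeMap (n + 1) :=
  Fin.snoc (α := fun _ => Fin (n + 1)) (fun i => (f i).castSucc) s

theorem one_le_degree {n : ℕ} (f : EdgeMap n) (s : Fin n) : 1 ≤ f.degree s := by
  unfold degree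
  refine le_trans ?_ (Finset.single_le_sum (fun i _ => Nat.zero_le _) (Finset.mem_univ s))
  simp

theorem sum_degree {n : ℕ} (f : EdgeMap n) : ∑ s, f.degree s = 2 * n := by
  unfold degree
  rw [Finset.sum_comm]
  simp [Finset.sum_add_distrib]
  ring

end EdgeMap

namespace BuckleyOsthus

/-- The probability that the vertex number `t = n + 1`, arriving when the graph `f` on `n` vertices
is already there, sends its edge to `s`: it is `(d(s) - 1 + a) / ((a + 1) t - 1)` for an old vertex
`s`, and `a / ((a + 1) t - 1)` for the new vertex. -/
noncomputable def stepProb (a : ℝ) {n : ℕ} (f : EdgeMap n) (s : Fin (n + 1)) : ℝ :=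
  Fin.snoc (α := fun _ => ℝ) (fun s : Fin n => (f.degree s : ℝ) - 1 + a) a s
    / ((a + 1) * ((n : ℝ) + 1) - 1)

theorem denom_pos {a : ℝ} (ha : 0 < a) (n : ℕ) : 0 < (a + 1) * ((n : ℝ) + 1) - 1 := by
  have hn : (0 : ℝ) ≤ n := Nat.cast_nonneg n
  nlinarith [mul_nonneg ha.le hn]

theorem stepProb_nonneg {a : ℝ} (ha : 0 < a) {n : ℕ} (f : EdgeMap n) (s : Fin (n + 1)) :
    0 ≤ stepProb a f s := by
  unfold stepProb
  refine div_nonneg ?_ (denom_pos ha n).le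
  induction s using Fin.lastCases with
  | last => simpa using ha.le
  | cast s =>
    have h : (1 : ℝ) ≤ f.degree s := by exact_mod_cast f.one_le_degree s
    simp only [Fin.snoc_castSucc]
    linarith

theorem sum_stepProb {a : ℝ} (ha : 0 < a) {n : ℕ} (f : EdgeMap n) :
    ∑ s, stepProb a f s = 1 := by
  have h : (∑ s, (f.degree s : ℝ)) = 2 * n := by exact_mod_cast f.sum_degree
  unfold stepProb
  rw [← Finset.sum_div, div_eq_one_iff_eq (denom_pos ha n).ne', Fin.sum_univ_castSucc]
  simp [Finset.sum_add_distrib, h]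
  ring

/-- The law of the endpoint of the edge that is added at the next step. -/
noncomputable def step {a : ℝ} (ha : 0 < a) {n : ℕ} (f : EdgeMap n) : PMF (Fin (n + 1)) :=
  PMF.ofFintype (fun s => ENNReal.ofReal (stepProb a f s)) (by
    rw [← ENNReal.ofReal_sum_of_nonneg fun s _ => stepProb_nonneg ha f s, sum_stepProb ha f,
      ENNReal.ofReal_one])

/-- The law of the Buckley–Osthus random graph `H_{a,1}^n`, built one vertex at a time from the empty
graph. -/
noncomputable def law {a : ℝ} (ha : 0 < a) : (n : ℕ) → PMF (EdgeMap n)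
  | 0 => PMF.pure Fin.elim0
  | n + 1 => (law ha n).bind fun f => (step ha f).map f.extend

/-- The expected number of vertices of `H_{a,1}^n` whose second degree is exactly `k`. -/
noncomputable def expectedCount {a : ℝ} (ha : 0 < a) (n k : ℕ) : ℝ :=
  ∫ f, (EdgeMap.countSecondDegree f k : ℝ) ∂(law ha n).toMeasure

end BuckleyOsthus

/-! The attachment weight of a vertex is its in-degree plus `a`. Because the graph is a forest with
loops, the total weight of the neighbours of a vertex `t` depends only on its second degree `k`, its
number of children `l` and its kind (loop, child of a loop, plain): it is `k + a * l` plus a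
constant (`Reachable.neighborWeight_eq`). One step therefore raises `l` with probability
proportional to `l + const` and `k` with probability proportional to `k + a * l + const`, and the
expected numbers of vertices of given kind, `l` and `k` satisfy a closed linear recursion. Births
are fed by the in-degree counts, which satisfy a similar recursion.

For plain vertices the recursion has the solution `limitProfile a k l * (stepDenom a n / (a + 1))`,
linear in `n`. The error obeys the same recursion with a bounded source over `stepDenom a n`, and `K
/ ((l + α) * (l + α + 1))` is a supersolution (`profile_error_le`): the gain from the drift in `l`
cancels the loss from the drift in `k`. It is uniform in `k` and summable in `l`. The two
exceptional kinds are bounded in the same way. Hence the expected count is `n * limitSecond a k +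
O(1)` uniformly in `k` (`expectedCount_sub_le`), and division by the main term turns the `O(1)` into
the error `k ^ (1 + a) / n`.

It remains to estimate `limitSecond a k`, the sum of the profile over `l`. Summing the stationary
equations over `l` gives a first-order recursion in `k` with source `birthRate` and a flux term
involving the mean number of children. The integrating factor `gammaRatio (a + 1)`, of order `k ^ (a
+ 1)`, turns the source into `limitConst a * (1 + O(1 / k))`, whose sum is the main term. The flux
is controlled through rising-factorial moments in `l`: the moment of order `r` obeys the same
recursion with `a + 1 - r` in place of `a + 1` and a flux bounded by the next moment. At order `⌈a⌉₊
+ 1` this parameter is nonpositive and the flux can be dropped (`profileMoment_top`); each descent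
by one order costs a logarithm (`profileMoment_descend`). The descent to order 1 costs `⌈a⌉₊`
logarithms and the last summation one more, hence the exponent `⌈a + 1⌉₊`. -/

/-! ### Asymptotics of quotients of Gamma functions -/

/-- The ratio `Γ(k + x) / Γ(k)`, which grows like `k ^ x`. -/
noncomputable def gammaRatio (x : ℝ) (k : ℕ) : ℝ := Real.Gamma (k + x) / Real.Gamma k

/-- The sequence `u` is `1 + O(1 / k)`. -/
def NearOne (u : ℕ → ℝ) : Prop := ∃ C : ℝ, 0 ≤ C ∧ ∀ k : ℕ, 1 ≤ k → |u k - 1| ≤ C / k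

namespace NearOne

theorem mul {u v : ℕ → ℝ} (hu : NearOne u) (hv : NearOne v) :
    NearOne fun k => u k * v k := by
  obtain ⟨C, hC, hu⟩ := hu
  obtain ⟨C', hC', hv⟩ := hv
  refine ⟨C * C' + C + C', by positivity, fun k hk => ?_⟩
  have hk1 : (1 : ℝ) ≤ k := by exact_mod_cast hk
  have h1 := hu k hk
  have h2 := hv k hk
  have e : u k * v k - 1 = (u k - 1) * (v k - 1) + (u k - 1) + (v k - 1) := by ring
  have h3 : |(u k - 1) * (v k - 1)| ≤ C * C' / k := by
    rw [abs_mul]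
    calc |u k - 1| * |v k - 1| ≤ (C / k) * (C' / k) := by gcongr
      _ = C * C' / k * (1 / k) := by ring
      _ ≤ C * C' / k * 1 := by
        gcongr
        rw [div_le_one (by linarith)]; exact hk1
      _ = _ := mul_one _
  calc |u k * v k - 1| ≤ |(u k - 1) * (v k - 1)| + |u k - 1| + |v k - 1| := by
        rw [e]; exact abs_add_three _ _ _
    _ ≤ C * C' / k + C / k + C' / k := by gcongr
    _ = _ := by ring

theorem bounded {u : ℕ → ℝ} (hu : NearOne u) :
    ∃ C : ℝ, 0 < C ∧ ∀ k : ℕ, 1 ≤ k → |u k| ≤ C := by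
  obtain ⟨C, hC, hu⟩ := hu
  refine ⟨C + 1, by positivity, fun k hk => ?_⟩
  have hk1 : (1 : ℝ) ≤ k := by exact_mod_cast hk
  have h1 := hu k hk
  have h2 : C / k ≤ C := div_le_self hC hk1
  calc |u k| = |(u k - 1) + 1| := by ring_nf
    _ ≤ |u k - 1| + |1| := abs_add_le _ _
    _ ≤ C + 1 := by rw [abs_one]; linarith

theorem congr {u v : ℕ → ℝ} (hu : NearOne u) (h : ∀ k : ℕ, 1 ≤ k → u k = v k) : NearOne v := by
  obtain ⟨C, hC, hu⟩ := hu
  exact ⟨C, hC, fun k hk => h k hk ▸ hu k hk⟩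

theorem add_div {x : ℝ} : NearOne fun k => ((k : ℝ) + x) / k := by
  refine ⟨|x|, abs_nonneg _, fun k hk => ?_⟩
  have hk1 : (0 : ℝ) < k := by exact_mod_cast hk
  have : ((k : ℝ) + x) / k - 1 = x / k := by field_simp; ring
  rw [this, abs_div, abs_of_pos hk1]

theorem div_add {x : ℝ} (hx : -1 < x) : NearOne fun k => (k : ℝ) / (k + x) := by
  have h0 : 0 < min 1 (1 + x) := lt_min one_pos (by linarith)
  refine ⟨|x| / min 1 (1 + x), by positivity, fun k hk => ?_⟩
  have hk1 : (1 : ℝ) ≤ k := by exact_mod_cast hk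
  have hkx : 0 < (k : ℝ) + x := by linarith
  have : (k : ℝ) / (k + x) - 1 = -x / (k + x) := by field_simp; ring
  rw [this, abs_div, abs_neg, abs_of_pos hkx, div_div]
  have : min 1 (1 + x) * k ≤ k + x := by
    rcases le_total x 0 with h | h
    · rw [min_eq_right (by linarith)]; nlinarith
    · rw [min_eq_left (by linarith)]; linarith
  gcongr

end NearOne

theorem gammaRatio_pos {x : ℝ} (hx : -1 < x) {k : ℕ} (hk : 1 ≤ k) : 0 < gammaRatio x k := by
  have hk1 : (1 : ℝ) ≤ k := by exact_mod_cast hk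
  exact div_pos (Real.Gamma_pos_of_pos (by linarith)) (Real.Gamma_pos_of_pos (by linarith))

theorem gammaRatio_add_one {x : ℝ} (hx : -1 < x) {k : ℕ} (hk : 1 ≤ k) :
    gammaRatio (x + 1) k = (k + x) * gammaRatio x k := by
  have hk1 : (1 : ℝ) ≤ k := by exact_mod_cast hk
  have h : (k : ℝ) + x ≠ 0 := by linarith
  unfold gammaRatio
  rw [← add_assoc, Real.Gamma_add_one h]
  ring

theorem gammaRatio_succ {x : ℝ} (hx : -1 < x) {k : ℕ} (hk : 1 ≤ k) :
    k * gammaRatio x (k + 1) = (k + x) * gammaRatio x k := by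
  have hk1 : (1 : ℝ) ≤ k := by exact_mod_cast hk
  have h : (k : ℝ) + x ≠ 0 := by linarith
  have h0 : (k : ℝ) ≠ 0 := by linarith
  have h1 : Real.Gamma k ≠ 0 := (Real.Gamma_pos_of_pos (by linarith)).ne'
  unfold gammaRatio
  push_cast
  rw [Real.Gamma_add_one h0, show (k : ℝ) + 1 + x = k + x + 1 by ring, Real.Gamma_add_one h]
  field_simp

/-- Log-convexity of Gamma between `y` and `y + 1`. -/
theorem gamma_add_le {x y : ℝ} (hy : 0 < y) (hx : 0 ≤ x) (hx1 : x ≤ 1) :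
    Real.Gamma (y + x) ≤ y ^ x * Real.Gamma y := by
  rcases hx.eq_or_lt with rfl | hx
  · simp
  rcases hx1.eq_or_lt with rfl | hx1
  · rw [Real.Gamma_add_one hy.ne', Real.rpow_one]
  have h := Real.Gamma_mul_add_mul_le_rpow_Gamma_mul_rpow_Gamma hy (t := y + 1) (by linarith)
    (a := 1 - x) (b := x) (by linarith) hx (by ring)
  have hg := Real.Gamma_pos_of_pos hy
  rw [show (1 - x) * y + x * (y + 1) = y + x by ring, Real.Gamma_add_one hy.ne',
    Real.mul_rpow hy.le hg.le] at h
  calc _ ≤ _ := h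
    _ = y ^ x * (Real.Gamma y ^ (1 - x) * Real.Gamma y ^ x) := by ring
    _ = _ := by rw [← Real.rpow_add hg]; simp

/-- The upper bound is log-convexity from `k` to `k + x`; the lower bound is the same inequality
from `k + x` to `k + 1`. -/
theorem gammaRatio_unit_bounds {x : ℝ} (hx : 0 ≤ x) (hx1 : x ≤ 1) {k : ℕ} (hk : 1 ≤ k) :
    (k : ℝ) / (k + x) ≤ gammaRatio x k / (k : ℝ) ^ x ∧ gammaRatio x k / (k : ℝ) ^ x ≤ 1 := by
  have hk0 : (0 : ℝ) < k := by exact_mod_cast hk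
  have hg := Real.Gamma_pos_of_pos hk0
  have hp : 0 < (k : ℝ) ^ x := by positivity
  have hkx : 0 < (k : ℝ) + x := by linarith
  unfold gammaRatio
  constructor
  · have h := gamma_add_le (y := k + x) (x := 1 - x) hkx (by linarith) (by linarith)
    rw [show (k : ℝ) + x + (1 - x) = k + 1 by ring, Real.Gamma_add_one hk0.ne'] at h
    rw [div_div, div_le_div_iff₀ hkx (by positivity)]
    have h2 : ((k : ℝ) + x) ^ (1 - x) * k ^ x ≤ k + x := by
      calc ((k : ℝ) + x) ^ (1 - x) * (k : ℝ) ^ x ≤ ((k : ℝ) + x) ^ (1 - x) * ((k : ℝ) + x) ^ x := by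
            gcongr; linarith
        _ = k + x := by rw [← Real.rpow_add hkx]; simp
    calc (k : ℝ) * (Real.Gamma k * (k : ℝ) ^ x) = (k * Real.Gamma k) * (k : ℝ) ^ x := by ring
      _ ≤ ((k + x : ℝ) ^ (1 - x) * Real.Gamma (k + x)) * (k : ℝ) ^ x := by gcongr
      _ = Real.Gamma (k + x) * ((k + x : ℝ) ^ (1 - x) * (k : ℝ) ^ x) := by ring
      _ ≤ Real.Gamma (k + x) * (k + x) := by gcongr
  · rw [div_div, div_le_one (by positivity), mul_comm]
    exact gamma_add_le hk0 hx hx1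

theorem nearOne_gammaRatio_unit {x : ℝ} (hx : 0 ≤ x) (hx1 : x ≤ 1) :
    NearOne (fun k => gammaRatio x k / (k : ℝ) ^ x) ∧
      NearOne (fun k => (k : ℝ) ^ x / gammaRatio x k) := by
  constructor
  · refine ⟨1, zero_le_one, fun k hk => ?_⟩
    have hk0 : (0 : ℝ) < k := by exact_mod_cast hk
    obtain ⟨h1, h2⟩ := gammaRatio_unit_bounds hx hx1 hk
    have h3 : 1 - 1 / (k : ℝ) ≤ k / (k + x) := by
      rw [le_div_iff₀ (by linarith)]
      have : (1 - 1 / (k : ℝ)) * (k + x) = k + x - 1 - x / k := by field_simp; ring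
      rw [this]
      have : 0 ≤ x / k := by positivity
      linarith
    rw [abs_le]
    constructor
    · linarith
    · have : 0 ≤ 1 / (k : ℝ) := by positivity
      linarith
  · refine ⟨1, zero_le_one, fun k hk => ?_⟩
    have hk0 : (0 : ℝ) < k := by exact_mod_cast hk
    obtain ⟨h1, h2⟩ := gammaRatio_unit_bounds hx hx1 hk
    have hg := gammaRatio_pos (x := x) (by linarith) hk
    have hp : 0 < (k : ℝ) ^ x := by positivity
    change |(k : ℝ) ^ x / gammaRatio x k - 1| ≤ 1 / k
    rw [← inv_div (gammaRatio x k)]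
    have hu : 0 < gammaRatio x k / (k : ℝ) ^ x := by positivity
    set u := gammaRatio x k / (k : ℝ) ^ x
    have h4 : 1 ≤ u⁻¹ := (one_le_inv₀ hu).2 h2
    have h5 : u⁻¹ ≤ ((k : ℝ) + x) / k := by
      rw [← inv_div (k : ℝ)]
      exact inv_anti₀ (by positivity) h1
    have h6 : ((k : ℝ) + x) / k ≤ 1 + 1 / k := by
      rw [_root_.add_div, div_self hk0.ne']
      gcongr
    have h7 : 0 ≤ 1 / (k : ℝ) := by positivity
    rw [abs_le]
    constructor <;> linarith

theorem nearOne_gammaRatio_add_one {x : ℝ} (hx : -1 < x)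
    (h : NearOne (fun k => gammaRatio x k / (k : ℝ) ^ x) ∧
      NearOne (fun k => (k : ℝ) ^ x / gammaRatio x k)) :
    NearOne (fun k => gammaRatio (x + 1) k / (k : ℝ) ^ (x + 1)) ∧
      NearOne (fun k => (k : ℝ) ^ (x + 1) / gammaRatio (x + 1) k) := by
  constructor
  · refine (h.1.mul (NearOne.add_div (x := x))).congr fun k hk => ?_
    have hk0 : (0 : ℝ) < k := by exact_mod_cast hk
    rw [gammaRatio_add_one hx hk, Real.rpow_add_one hk0.ne']
    field_simp
  · refine (h.2.mul (NearOne.div_add hx)).congr fun k hk => ?_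
    have hk0 : (1 : ℝ) ≤ k := by exact_mod_cast hk
    rw [gammaRatio_add_one hx hk, Real.rpow_add_one (by linarith)]
    have := gammaRatio_pos hx hk
    have : (k : ℝ) + x ≠ 0 := by linarith
    field_simp

theorem nearOne_gammaRatio_of_nonneg {x : ℝ} (hx : 0 ≤ x) :
    NearOne (fun k => gammaRatio x k / (k : ℝ) ^ x) ∧
      NearOne (fun k => (k : ℝ) ^ x / gammaRatio x k) := by
  have key : ∀ n : ℕ, ∀ x : ℝ, 0 ≤ x → x ≤ n + 1 →
      NearOne (fun k => gammaRatio x k / (k : ℝ) ^ x) ∧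
      NearOne (fun k => (k : ℝ) ^ x / gammaRatio x k) := by
    intro n
    induction n with
    | zero => intro x h0 h1; exact nearOne_gammaRatio_unit h0 (by simpa using h1)
    | succ n ih =>
      intro x h0 h1
      rcases le_total x 1 with h | h
      · exact nearOne_gammaRatio_unit h0 h
      · have := nearOne_gammaRatio_add_one (x := x - 1) (by linarith)
          (ih (x - 1) (by linarith) (by push_cast at h1; linarith))
        simpa using this
  obtain ⟨n, hn⟩ := exists_nat_ge x
  exact key n x hx (by linarith)

/-- The functional equation transfers the case `x + 1 > 0` down to `x`. Exponents in `(-1, 0)` occur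
as `a + 1 - r` for the top moment. -/
theorem nearOne_gammaRatio {x : ℝ} (hx : -1 < x) :
    NearOne (fun k => gammaRatio x k / (k : ℝ) ^ x) ∧
      NearOne (fun k => (k : ℝ) ^ x / gammaRatio x k) := by
  have h := nearOne_gammaRatio_of_nonneg (x := x + 1) (by linarith)
  constructor
  · refine (h.1.mul (NearOne.div_add hx)).congr fun k hk => ?_
    have hk0 : (1 : ℝ) ≤ k := by exact_mod_cast hk
    have : (k : ℝ) + x ≠ 0 := by linarith
    rw [gammaRatio_add_one hx hk, Real.rpow_add_one (by linarith)]
    field_simp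
  · refine (h.2.mul (NearOne.add_div (x := x))).congr fun k hk => ?_
    have hk0 : (1 : ℝ) ≤ k := by exact_mod_cast hk
    have : (k : ℝ) + x ≠ 0 := by linarith
    have := gammaRatio_pos hx hk
    rw [gammaRatio_add_one hx hk, Real.rpow_add_one (by linarith)]
    field_simp

/-- `Γ(k + x) / Γ(k)` has the order of magnitude of `k ^ x`. -/
theorem gammaRatio_order {x : ℝ} (hx : -1 < x) :
    ∃ C : ℝ, 0 < C ∧ ∀ k : ℕ, 1 ≤ k →
      gammaRatio x k ≤ C * (k : ℝ) ^ x ∧ (k : ℝ) ^ x ≤ C * gammaRatio x k := by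
  obtain ⟨C, hC, h⟩ := (nearOne_gammaRatio hx).1.bounded
  obtain ⟨C', hC', h'⟩ := (nearOne_gammaRatio hx).2.bounded
  refine ⟨max C C', by positivity, fun k hk => ?_⟩
  have hk0 : (0 : ℝ) < k := by exact_mod_cast hk
  have hg := gammaRatio_pos hx hk
  have hp : 0 < (k : ℝ) ^ x := by positivity
  have h1 := (le_abs_self _).trans (h k hk)
  have h2 := (le_abs_self _).trans (h' k hk)
  rw [div_le_iff₀ (by positivity)] at h1 h2
  exact ⟨h1.trans (by gcongr; exact le_max_left _ _), h2.trans (by gcongr; exact le_max_right _ _)⟩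

/-! ### The limiting in-degree law and the limiting profile -/

/-- The constant `(a + 1) Γ(2 a + 1) / Γ(a)`. -/
noncomputable def limitConst (a : ℝ) : ℝ := (a + 1) * Real.Gamma (2 * a + 1) / Real.Gamma a

theorem limitConst_pos {a : ℝ} (ha : 0 < a) : 0 < limitConst a := by
  have h1 := Real.Gamma_pos_of_pos ha
  have h2 := Real.Gamma_pos_of_pos (show 0 < 2 * a + 1 by linarith)
  unfold limitConst
  positivity

/-- The limiting proportion of vertices with in-degree `j`. -/
noncomputable def limitDegree (a : ℝ) (j : ℕ) : ℝ :=
  limitConst a * Real.Gamma (j + a) / Real.Gamma (j + 2 * a + 2)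

theorem limitDegree_pos {a : ℝ} (ha : 0 < a) (j : ℕ) : 0 < limitDegree a j := by
  have h1 := Real.Gamma_pos_of_pos (show 0 < (j : ℝ) + a by positivity)
  have h2 := Real.Gamma_pos_of_pos (show 0 < (j : ℝ) + 2 * a + 2 by positivity)
  have := limitConst_pos ha
  unfold limitDegree
  positivity

theorem limitDegree_zero {a : ℝ} (ha : 0 < a) : limitDegree a 0 * (2 * a + 1) = a + 1 := by
  have h1 := Real.Gamma_pos_of_pos ha
  have h2 := Real.Gamma_pos_of_pos (show 0 < 2 * a + 1 by linarith)
  unfold limitDegree limitConst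
  rw [Nat.cast_zero, zero_add, zero_add, show 2 * a + 2 = (2 * a + 1) + 1 by ring,
    Real.Gamma_add_one (s := 2 * a + 1) (by positivity)]
  field_simp

/-- Stationarity: with counts growing like `stepDenom a n / (a + 1)`, the growth adds `a + 1` to the
exit rate `j + 1 + a`. -/
theorem limitDegree_succ {a : ℝ} (ha : 0 < a) (j : ℕ) :
    limitDegree a (j + 1) * (j + 1 + 2 * a + 1) = limitDegree a j * (j + a) := by
  have h2 := Real.Gamma_pos_of_pos (show 0 < (j : ℝ) + 2 * a + 2 by positivity)
  unfold limitDegree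
  push_cast
  rw [show (j : ℝ) + 1 + a = j + a + 1 by ring, Real.Gamma_add_one (by positivity),
    show (j : ℝ) + 1 + 2 * a + 2 = (j + 2 * a + 2) + 1 by ring, Real.Gamma_add_one (by positivity)]
  have : (j : ℝ) + 1 + 2 * a + 1 ≠ 0 := by positivity
  have : (j : ℝ) + 2 * a + 2 ≠ 0 := by positivity
  field_simp
  ring

/-- Monotonicity of Gamma on `[2, ∞)` compares the denominator with `Γ(j + a + 2)`. -/
theorem limitDegree_le {a : ℝ} (ha : 0 < a) (j : ℕ) :
    limitDegree a j * ((j + a) * (j + a + 1)) ≤ limitConst a := by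
  have h2 := Real.Gamma_pos_of_pos (show 0 < (j : ℝ) + 2 * a + 2 by positivity)
  have h3 : Real.Gamma (j + a + 2) ≤ Real.Gamma (j + 2 * a + 2) :=
    Real.Gamma_strictMonoOn_Ici.monotoneOn (show (2 : ℝ) ≤ j + a + 2 by
      have : (0 : ℝ) ≤ j := j.cast_nonneg
      linarith) (show (2 : ℝ) ≤ j + 2 * a + 2 by
      have : (0 : ℝ) ≤ j := j.cast_nonneg
      linarith) (by linarith)
  rw [show (j : ℝ) + a + 2 = j + a + 1 + 1 by ring, Real.Gamma_add_one (by positivity),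
    Real.Gamma_add_one (by positivity)] at h3
  have hc := limitConst_pos ha
  unfold limitDegree
  rw [div_mul_eq_mul_div, div_le_iff₀ h2]
  calc _ = limitConst a * ((j + a + 1) * ((j + a) * Real.Gamma (j + a))) := by ring
    _ ≤ _ := by gcongr

/-- The rate at which vertices with second degree `k + 1` and no children are born. -/
noncomputable def birthRate (a : ℝ) (k : ℕ) : ℝ := (k + a) * limitDegree a k

theorem birthRate_nonneg {a : ℝ} (ha : 0 < a) (k : ℕ) : 0 ≤ birthRate a k :=
  mul_nonneg (by positivity) (limitDegree_pos ha k).le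

theorem birthRate_le {a : ℝ} (ha : 0 < a) (k : ℕ) :
    birthRate a k * (k + a + 1) ≤ limitConst a := by
  have := limitDegree_le ha k
  unfold birthRate
  linarith

theorem birthRate_eq {a : ℝ} (ha : 0 < a) (k : ℕ) :
    birthRate a k
      = limitConst a * (gammaRatio a (k + 1) / gammaRatio (2 * a + 1) (k + 1)) := by
  have h1 := Real.Gamma_pos_of_pos (show 0 < ((k + 1 : ℕ) : ℝ) by positivity)
  have h2 := Real.Gamma_pos_of_pos (show 0 < (k : ℝ) + 2 * a + 2 by positivity)
  unfold birthRate limitDegree gammaRatio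
  push_cast at *
  rw [show (k : ℝ) + 1 + a = k + a + 1 by ring, Real.Gamma_add_one (by positivity),
    show (k : ℝ) + 1 + (2 * a + 1) = k + 2 * a + 2 by ring]
  field_simp

/-- One more row of `limitProfile`. -/
noncomputable def profileStep (a : ℝ) (k : ℕ) (row : ℕ → ℝ) : ℕ → ℝ
  | 0 => ((k + a) * row 0 + birthRate a k) / (k + 2 + 3 * a)
  | l + 1 => ((l + a) * profileStep a k row l + (k + a + a * (l + 1)) * row (l + 1))
      / ((l + 1) * (a + 1) + k + 2 + 3 * a)

/-- The limiting proportion of vertices with second degree `k` and `l` children. -/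
noncomputable def limitProfile (a : ℝ) : ℕ → ℕ → ℝ
  | 0 => fun _ => 0
  | k + 1 => profileStep a k (limitProfile a k)

theorem limitProfile_succ_zero {a : ℝ} (ha : 0 < a) (k : ℕ) :
    limitProfile a (k + 1) 0 * (k + 2 + 3 * a)
      = (k + a) * limitProfile a k 0 + birthRate a k := by
  have : (k : ℝ) + 2 + 3 * a ≠ 0 := by positivity
  simp only [limitProfile, profileStep]
  field_simp

theorem limitProfile_succ_succ {a : ℝ} (ha : 0 < a) (k l : ℕ) :
    limitProfile a (k + 1) (l + 1) * ((l + 1) * (a + 1) + k + 2 + 3 * a)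
      = (l + a) * limitProfile a (k + 1) l
        + (k + a + a * (l + 1)) * limitProfile a k (l + 1) := by
  have : ((l : ℝ) + 1) * (a + 1) + k + 2 + 3 * a ≠ 0 := by positivity
  simp only [limitProfile]
  conv_lhs => rw [profileStep]
  field_simp

theorem limitProfile_nonneg {a : ℝ} (ha : 0 < a) (k l : ℕ) : 0 ≤ limitProfile a k l := by
  induction k generalizing l with
  | zero => exact le_rfl
  | succ k ihk =>
    induction l with
    | zero =>
      refine nonneg_of_mul_nonneg_left (b := (k : ℝ) + 2 + 3 * a) ?_ (by positivity)
      rw [limitProfile_succ_zero ha]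
      have := ihk 0
      have := birthRate_nonneg ha k
      positivity
    | succ l ihl =>
      refine nonneg_of_mul_nonneg_left (b := ((l : ℝ) + 1) * (a + 1) + k + 2 + 3 * a) ?_
        (by positivity)
      rw [limitProfile_succ_succ ha]
      have := ihk (l + 1)
      positivity

/-- The right-hand side is a supersolution of the stationary equations, by induction on `k` and then
`l`. The weight on the left is the exit rate plus `a + 1`; it is needed later to bound the limiting
count in states the graph is too small to occupy. -/
theorem limitProfile_le {a : ℝ} (ha : 0 < a) (k l : ℕ) :
    limitProfile a k l * (l * (a + 1) + k + 1 + 3 * a)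
      ≤ 2 * a * limitConst a / ((l + a) * (l + a + 1)) := by
  have hA := limitConst_pos ha
  induction k generalizing l with
  | zero => simp only [limitProfile, zero_mul]; positivity
  | succ k ihk =>
    induction l with
    | zero =>
      have h1 := ihk 0
      have h2 := birthRate_le ha k
      have h3 := limitProfile_succ_zero ha k
      push_cast at *
      rw [show (0 : ℝ) * (a + 1) + (k + 1) + 1 + 3 * a = k + 2 + 3 * a by ring, h3]
      simp only [zero_mul, zero_add] at *
      have e : 2 * a * limitConst a / (a * (a + 1)) = 2 * limitConst a / (a + 1) := by
        field_simp
      rw [e] at h1 ⊢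
      have h4 : limitProfile a k 0 ≤ 2 * limitConst a / (a + 1) / (k + 1 + 3 * a) := by
        rw [le_div_iff₀ (by positivity)]; exact h1
      have h5 : birthRate a k ≤ limitConst a / (k + a + 1) := by
        rw [le_div_iff₀ (by positivity)]; exact h2
      calc (k + a) * limitProfile a k 0 + birthRate a k
          ≤ (k + a) * (2 * limitConst a / (a + 1) / (k + 1 + 3 * a))
            + limitConst a / (k + a + 1) := by gcongr
        _ ≤ (k + a) * (2 * limitConst a / (a + 1) / (k + 1 + 3 * a))
            + 2 * limitConst a / (a + 1) / (k + 1 + 3 * a) * (2 * a + 1) := by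
          gcongr
          rw [div_div, div_mul_eq_mul_div, div_le_div_iff₀ (by positivity) (by positivity)]
          have hk : (0 : ℝ) ≤ k := k.cast_nonneg
          -- The factor 2 in the constant of the supersolution gives the room needed to absorb
          -- births.
          have : (a + 1) * (k + 1 + 3 * a) ≤ 2 * (2 * a + 1) * (k + a + 1) := by nlinarith
          nlinarith [mul_le_mul_of_nonneg_left this hA.le]
        _ = 2 * limitConst a / (a + 1) := by
          have : (k : ℝ) + 1 + 3 * a ≠ 0 := by positivity
          field_simp
          ring
    | succ l ihl =>
      have h1 := ihk (l + 1)
      have h3 := limitProfile_succ_succ ha k l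
      push_cast at *
      set K := 2 * a * limitConst a with hK
      have hKpos : 0 < K := by positivity
      rw [show ((l : ℝ) + 1) * (a + 1) + (k + 1) + 1 + 3 * a
        = (l + 1) * (a + 1) + k + 2 + 3 * a by ring, h3]
      have hW : 0 < (l : ℝ) * (a + 1) + k + 2 + 3 * a := by positivity
      have h4 : limitProfile a (k + 1) l
          ≤ K / ((l + a) * (l + a + 1)) / (l * (a + 1) + k + 2 + 3 * a) := by
        rw [le_div_iff₀ hW]
        exact le_trans (le_of_eq (by ring)) ihl
      -- Both inflows are divided by the weight at `(k + 1, l)`, which is at most the weight at `(k,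
      -- l + 1)`; after that the two contributions add up exactly.
      have h5 : limitProfile a k (l + 1)
          ≤ K / ((l + 1 + a) * (l + 1 + a + 1)) / (l * (a + 1) + k + 2 + 3 * a) := by
        refine le_trans ?_ (div_le_div_of_nonneg_right h1 hW.le)
        rw [le_div_iff₀ hW]
        refine mul_le_mul_of_nonneg_left ?_ (limitProfile_nonneg ha _ _)
        linarith
      calc (l + a) * limitProfile a (k + 1) l + (k + a + a * (l + 1)) * limitProfile a k (l + 1)
          ≤ (l + a) * (K / ((l + a) * (l + a + 1)) / (l * (a + 1) + k + 2 + 3 * a))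
            + (k + a + a * (l + 1))
              * (K / ((l + 1 + a) * (l + 1 + a + 1)) / (l * (a + 1) + k + 2 + 3 * a)) := by
            gcongr
        _ = K / ((l + 1 + a) * (l + 1 + a + 1)) := by
          have : (l : ℝ) + a ≠ 0 := by positivity
          have : (l : ℝ) + a + 1 ≠ 0 := by positivity
          have : (l : ℝ) + 1 + a ≠ 0 := by positivity
          have : (l : ℝ) + 1 + a + 1 ≠ 0 := by positivity
          field_simp
          ring

/-! ### Rising-factorial moments in the number of children -/

open Filter Topology

/-- The rising factorial of `l + a` with `r` factors. -/
noncomputable def risingFactor (a : ℝ) : ℕ → ℕ → ℝ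
  | 0, _ => 1
  | r + 1, l => risingFactor a r l * (l + a + r)

theorem risingFactor_pos {a : ℝ} (ha : 0 < a) (r l : ℕ) : 0 < risingFactor a r l := by
  induction r with
  | zero => exact one_pos
  | succ r ih => rw [risingFactor]; positivity

/-- Rising factorials are eigenfunctions of the birth process with rate `l + a`: a jump from `l` to
`l + 1` increases the weight by `r * risingFactor a r l` after multiplication by the rate. This is
why they replace plain powers. -/
theorem risingFactor_shift (a : ℝ) (r l : ℕ) :
    risingFactor a r (l + 1) * (l + a) = (l + a + r) * risingFactor a r l := by
  induction r with
  | zero => simp [risingFactor]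
  | succ r ih =>
    simp only [risingFactor]
    push_cast
    linear_combination ((l : ℝ) + 1 + a + r) * ih

/-- The moment of order `r` of the number of children (below `L`) at second degree `k`. -/
noncomputable def profileMoment (a : ℝ) (r L k : ℕ) : ℝ :=
  ∑ l ∈ Finset.range L, risingFactor a r l * limitProfile a k l

/-- The same moment, weighted by `a (l + 1)`. -/
noncomputable def profileFlux (a : ℝ) (r L k : ℕ) : ℝ :=
  ∑ l ∈ Finset.range L, risingFactor a r l * (a * l + a) * limitProfile a k l

theorem profileMoment_nonneg {a : ℝ} (ha : 0 < a) (r L k : ℕ) : 0 ≤ profileMoment a r L k :=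
  Finset.sum_nonneg fun l _ => mul_nonneg (risingFactor_pos ha r l).le (limitProfile_nonneg ha k l)

theorem profileFlux_nonneg {a : ℝ} (ha : 0 < a) (r L k : ℕ) : 0 ≤ profileFlux a r L k :=
  Finset.sum_nonneg fun l _ => mul_nonneg
    (mul_nonneg (risingFactor_pos ha r l).le (by positivity)) (limitProfile_nonneg ha k l)

theorem profileFlux_le {a : ℝ} (ha : 0 < a) (r L k : ℕ) :
    profileFlux a r L k ≤ (a + 1) * profileMoment a (r + 1) L k := by
  unfold profileFlux profileMoment
  rw [Finset.mul_sum]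
  refine Finset.sum_le_sum fun l _ => ?_
  rw [← mul_assoc]
  refine mul_le_mul_of_nonneg_right ?_ (limitProfile_nonneg ha k l)
  rw [risingFactor]
  have hp := risingFactor_pos ha r l
  have h : a * l + a ≤ (a + 1) * (l + a + r) := by
    have : (0 : ℝ) ≤ l := l.cast_nonneg
    have : (0 : ℝ) ≤ r := r.cast_nonneg
    nlinarith [mul_nonneg ha.le this, sq_nonneg a]
  calc _ ≤ risingFactor a r l * ((a + 1) * (l + a + r)) := by gcongr
    _ = _ := by ring

/-- The stationary equations weighted by `risingFactor a r` and summed over `l ≤ L`. The eigenvalue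
`r` lowers the coefficient `a + 1` to `a + 1 - r`; the extra term on the left is the mass that
leaves through the cutoff. -/
theorem profileMoment_balance {a : ℝ} (ha : 0 < a) (r L k : ℕ) :
    (k + 1 + (a + 1 - r)) * profileMoment a r (L + 1) (k + 1) + profileFlux a r (L + 1) (k + 1)
        + risingFactor a r (L + 1) * (L + a) * limitProfile a (k + 1) L
      = k * profileMoment a r (L + 1) k + profileFlux a r (L + 1) k
        + risingFactor a r 0 * birthRate a k := by
  unfold profileMoment profileFlux
  induction L with
  | zero =>
    have h := limitProfile_succ_zero ha k
    have h2 := risingFactor_shift a r 0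
    simp only [zero_add, Finset.sum_range_one, Nat.cast_zero] at *
    linear_combination risingFactor a r 0 * h + limitProfile a (k + 1) 0 * h2
  | succ L ih =>
    rw [Finset.sum_range_succ _ (L + 1), Finset.sum_range_succ _ (L + 1),
      Finset.sum_range_succ _ (L + 1), Finset.sum_range_succ _ (L + 1)]
    have h := limitProfile_succ_succ ha k L
    have h2 := risingFactor_shift a r (L + 1)
    push_cast at *
    linear_combination ih + risingFactor a r (L + 1) * h + limitProfile a (k + 1) (L + 1) * h2

/-- Dropping the nonnegative cutoff term gives an inequality valid for every `L`, so moments can be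
bounded before their convergence is known. -/
theorem profileMoment_step {a : ℝ} (ha : 0 < a) (r L k : ℕ) :
    (k + 1 + (a + 1 - r)) * profileMoment a r L (k + 1) + profileFlux a r L (k + 1)
      ≤ k * profileMoment a r L k + profileFlux a r L k + risingFactor a r 0 * birthRate a k := by
  have h0 := mul_nonneg (risingFactor_pos ha r 0).le (birthRate_nonneg ha k)
  cases L with
  | zero => simpa [profileMoment, profileFlux] using h0
  | succ L =>
    rw [← profileMoment_balance ha r L k]
    have := mul_nonneg (mul_nonneg (risingFactor_pos ha r (L + 1)).le
      (show (0 : ℝ) ≤ L + a by positivity)) (limitProfile_nonneg ha (k + 1) L)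
    linarith

/-! ### Summation by parts and decay of the moments -/

/-- Summation by parts for a first-order recursion with a flux term. -/
theorem recursion_sum_by_parts {θ : ℝ} (hθ : -1 < θ) {m g s : ℕ → ℝ} (hg : g 0 = 0)
    (h : ∀ k : ℕ, (k + 1 + θ) * m (k + 1) + g (k + 1) ≤ k * m k + g k + s k) (K : ℕ) :
    (K + 1 + θ) * gammaRatio θ (K + 1) * m (K + 1) + gammaRatio θ (K + 1) * g (K + 1)
      ≤ ∑ j ∈ Finset.range (K + 1), gammaRatio θ (j + 1) * s j
        + ∑ j ∈ Finset.range K, θ / (j + 1) * gammaRatio θ (j + 1) * g (j + 1) := by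
  induction K with
  | zero =>
    have hv := gammaRatio_pos hθ le_rfl
    have h0 := mul_le_mul_of_nonneg_left (h 0) hv.le
    simp only [zero_add, Finset.sum_range_one, Finset.sum_range_zero, Nat.cast_zero, hg] at *
    linarith
  | succ K ih =>
    have hv := gammaRatio_pos hθ (show 1 ≤ K + 1 + 1 by omega)
    have hs := gammaRatio_succ hθ (show 1 ≤ K + 1 by omega)
    have h0 := mul_le_mul_of_nonneg_left (h (K + 1)) hv.le
    rw [Finset.sum_range_succ _ (K + 1),
      Finset.sum_range_succ (fun j : ℕ => θ / ((j : ℝ) + 1) * gammaRatio θ (j + 1) * g (j + 1)) K]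
    -- Since `k * gammaRatio θ (k + 1) = (k + θ) * gammaRatio θ k`, this integrating factor makes
    -- the `m` terms telescope; its increment `θ / (K + 1)` times itself is what the summation by
    -- parts leaves on the flux.
    have hs' : gammaRatio θ (K + 1 + 1)
        = gammaRatio θ (K + 1) + θ / (K + 1) * gammaRatio θ (K + 1) := by
      have : (K : ℝ) + 1 ≠ 0 := by positivity
      push_cast at hs
      field_simp
      linear_combination hs
    have e1 : gammaRatio θ (K + 1 + 1) * ((K + 1 : ℕ) * m (K + 1))
        = (K + 1 + θ) * gammaRatio θ (K + 1) * m (K + 1) := by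
      rw [← mul_assoc, mul_comm (gammaRatio θ _), hs]
      push_cast
      ring
    have e2 : gammaRatio θ (K + 1 + 1) * g (K + 1) = gammaRatio θ (K + 1) * g (K + 1)
        + θ / (K + 1) * gammaRatio θ (K + 1) * g (K + 1) := by rw [hs']; ring
    rw [mul_add, mul_add, mul_add, e1, e2] at h0
    push_cast at *
    linarith

/-- The reverse inequality is the previous result for `-m`, `-g`, `-s`, as no sign was assumed. -/
theorem recursion_sum_by_parts_eq {θ : ℝ} (hθ : -1 < θ) {m g s : ℕ → ℝ} (hg : g 0 = 0)
    (h : ∀ k : ℕ, (k + 1 + θ) * m (k + 1) + g (k + 1) = k * m k + g k + s k) (K : ℕ) :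
    (K + 1 + θ) * gammaRatio θ (K + 1) * m (K + 1) + gammaRatio θ (K + 1) * g (K + 1)
      = ∑ j ∈ Finset.range (K + 1), gammaRatio θ (j + 1) * s j
        + ∑ j ∈ Finset.range K, θ / (j + 1) * gammaRatio θ (j + 1) * g (j + 1) := by
  refine le_antisymm (recursion_sum_by_parts hθ hg (fun k => (h k).le) K) ?_
  have := recursion_sum_by_parts hθ (m := fun k => -m k) (g := fun k => -g k)
    (s := fun k => -s k) (by simp [hg]) (fun k => by linarith [h k]) K
  simp only [mul_neg, Finset.sum_neg_distrib] at this
  linarith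

/-- The logarithm, kept away from zero. -/
noncomputable def posLog (k : ℕ) : ℝ := Real.log (max (k : ℝ) 2)

theorem half_le_posLog (k : ℕ) : 1 / 2 ≤ posLog k := by
  have h : Real.log 2 ≤ posLog k := Real.log_le_log two_pos (le_max_right _ _)
  have := Real.log_two_gt_d9
  linarith

theorem posLog_mono {j k : ℕ} (h : j ≤ k) : posLog j ≤ posLog k :=
  Real.log_le_log (by positivity) (max_le_max (by exact_mod_cast h) le_rfl)

theorem sum_inv_le_posLog (k : ℕ) :
    ∑ j ∈ Finset.range (k + 1), 1 / ((j : ℝ) + 1) ≤ 3 * posLog (k + 1) := by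
  have h := harmonic_le_one_add_log (k + 1)
  have h1 : Real.log ((k + 1 : ℕ) : ℝ) ≤ posLog (k + 1) :=
    Real.log_le_log (by positivity) (le_max_left _ _)
  have h2 := half_le_posLog (k + 1)
  have e : ((harmonic (k + 1) : ℚ) : ℝ) = ∑ j ∈ Finset.range (k + 1), 1 / ((j : ℝ) + 1) := by
    simp [harmonic]
  rw [e] at h
  linarith

/-- Used to absorb bounds without logarithms into bounds with them. -/
theorem le_pow_posLog {k : ℕ} (i : ℕ) : 1 ≤ 2 ^ i * posLog k ^ i := by
  rw [← mul_pow]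
  have := half_le_posLog k
  exact one_le_pow₀ (by linarith)

theorem sum_inv_sq_le (K : ℕ) : ∑ j ∈ Finset.range (K + 1), 1 / ((j : ℝ) + 1) ^ 2 ≤ 2 := by
  have key : ∑ j ∈ Finset.range (K + 1), 1 / ((j : ℝ) + 1) ^ 2 ≤ 2 - 1 / ((K : ℝ) + 1) := by
    induction K with
    | zero => norm_num
    | succ K ih =>
      rw [Finset.sum_range_succ]
      have h : 1 / ((K : ℝ) + 1 + 1) ^ 2 ≤ 1 / ((K : ℝ) + 1) - 1 / ((K : ℝ) + 1 + 1) := by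
        rw [div_sub_div _ _ (by positivity) (by positivity),
          div_le_div_iff₀ (by positivity) (by positivity)]
        have : (0 : ℝ) ≤ K := K.cast_nonneg
        nlinarith
      push_cast
      linarith
  have : 0 ≤ 1 / ((K : ℝ) + 1) := by positivity
  linarith

theorem birthRate_order {a : ℝ} (ha : 0 < a) :
    ∃ C : ℝ, 0 < C ∧ ∀ j : ℕ, birthRate a j ≤ C * ((j : ℝ) + 1) ^ (-(a + 1)) := by
  obtain ⟨C1, hC1, h1⟩ := gammaRatio_order (show -1 < a by linarith)
  obtain ⟨C2, hC2, h2⟩ := gammaRatio_order (show -1 < 2 * a + 1 by linarith)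
  have hA := limitConst_pos ha
  refine ⟨limitConst a * (C1 * C2), by positivity, fun j => ?_⟩
  have hj : (0 : ℝ) < j + 1 := by positivity
  have h1 := (h1 (j + 1) (by omega)).1
  have h2 := (h2 (j + 1) (by omega)).2
  have hg := gammaRatio_pos (show -1 < 2 * a + 1 by linarith) (show 1 ≤ j + 1 by omega)
  push_cast at *
  rw [birthRate_eq ha, mul_assoc]
  gcongr
  rw [div_le_iff₀ hg]
  calc gammaRatio a (j + 1) ≤ C1 * ((j : ℝ) + 1) ^ a := h1
    _ = C1 * (((j : ℝ) + 1) ^ (-(a + 1)) * ((j : ℝ) + 1) ^ (2 * a + 1)) := by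
      rw [← Real.rpow_add hj]; ring_nf
    _ ≤ C1 * (((j : ℝ) + 1) ^ (-(a + 1)) * (C2 * gammaRatio (2 * a + 1) (j + 1))) := by gcongr
    _ = _ := by ring

/-- The orders `a + 1 - r` and `-(a + 1)` add up to `-r`, so the weighted source is summable for `r
≥ 2` and logarithmic for `r = 1`. -/
theorem gammaRatio_mul_birthRate_le {a : ℝ} (ha : 0 < a) {r : ℕ} (hr : (r : ℝ) < a + 2) :
    ∃ C : ℝ, 0 < C ∧ ∀ j : ℕ,
      gammaRatio (a + 1 - r) (j + 1) * birthRate a j ≤ C * (1 / ((j : ℝ) + 1) ^ r) := by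
  obtain ⟨C1, hC1, h1⟩ := gammaRatio_order (show -1 < a + 1 - r by linarith)
  obtain ⟨C2, hC2, h2⟩ := birthRate_order ha
  refine ⟨C1 * C2, by positivity, fun j => ?_⟩
  have hj : (0 : ℝ) < j + 1 := by positivity
  have h1 := (h1 (j + 1) (by omega)).1
  have hb := birthRate_nonneg ha j
  push_cast at *
  calc _ ≤ (C1 * ((j : ℝ) + 1) ^ (a + 1 - r)) * (C2 * ((j : ℝ) + 1) ^ (-(a + 1))) := by
        gcongr
        exact h2 j
    _ = C1 * C2 * (((j : ℝ) + 1) ^ (a + 1 - r) * ((j : ℝ) + 1) ^ (-(a + 1))) := by ring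
    _ = _ := by
      rw [← Real.rpow_add hj, show a + 1 - (r : ℝ) + -(a + 1) = -r by ring, Real.rpow_neg hj.le,
        Real.rpow_natCast, one_div]

theorem le_of_gammaRatio_mul_le {θ : ℝ} (hθ : -1 < θ) :
    ∃ C : ℝ, 0 < C ∧ ∀ (K : ℕ) (x B : ℝ), 0 ≤ x →
      (K + 1 + θ) * gammaRatio θ (K + 1) * x ≤ B → x ≤ C * B * ((K : ℝ) + 1) ^ (-θ - 1) := by
  obtain ⟨C, hC, h⟩ := gammaRatio_order (show -1 < θ + 1 by linarith)
  refine ⟨C, hC, fun K x B hx hB => ?_⟩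
  have hK : (0 : ℝ) < K + 1 := by positivity
  have h := (h (K + 1) (by omega)).2
  rw [gammaRatio_add_one hθ (by omega)] at h
  push_cast at h
  calc x = ((K : ℝ) + 1) ^ (θ + 1) * x * ((K : ℝ) + 1) ^ (-θ - 1) := by
        rw [mul_right_comm, ← Real.rpow_add hK]; simp
    _ ≤ (C * ((K + 1 + θ) * gammaRatio θ (K + 1))) * x * ((K : ℝ) + 1) ^ (-θ - 1) := by gcongr
    _ = C * ((K + 1 + θ) * gammaRatio θ (K + 1) * x) * ((K : ℝ) + 1) ^ (-θ - 1) := by ring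
    _ ≤ _ := by gcongr

/-- Here `θ = a + 1 - r` lies in `(-1, 0]`, so the flux sum has the favourable sign and no higher
moment is needed. -/
theorem profileMoment_top {a : ℝ} (ha : 0 < a) {r : ℕ} (hr2 : 2 ≤ r) (hr : a + 1 ≤ r)
    (hr' : (r : ℝ) < a + 2) :
    ∃ C : ℝ, 0 < C ∧ ∀ L K : ℕ,
      profileMoment a r L (K + 1) ≤ C * ((K : ℝ) + 1) ^ ((r : ℝ) - a - 2) := by
  have hθ : -1 < a + 1 - r := by linarith
  obtain ⟨C1, hC1, h1⟩ := gammaRatio_mul_birthRate_le ha hr'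
  obtain ⟨C2, hC2, h2⟩ := le_of_gammaRatio_mul_le hθ
  have hf := risingFactor_pos ha r 0
  refine ⟨C2 * (risingFactor a r 0 * C1 * 2), by positivity, fun L K => ?_⟩
  have key := recursion_sum_by_parts hθ (m := profileMoment a r L) (g := profileFlux a r L)
    (s := fun k => risingFactor a r 0 * birthRate a k) (by simp [profileFlux, limitProfile])
    (profileMoment_step ha r L) K
  have h3 := h2 K _ (risingFactor a r 0 * C1 * 2) (profileMoment_nonneg ha r L (K + 1)) ?_
  · rw [show -(a + 1 - (r : ℝ)) - 1 = r - a - 2 by ring] at h3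
    linarith
  have hflux := mul_nonneg (gammaRatio_pos hθ (show 1 ≤ K + 1 by omega)).le
    (profileFlux_nonneg ha r L (K + 1))
  have hneg : ∑ j ∈ Finset.range K,
      (a + 1 - r) / (j + 1) * gammaRatio (a + 1 - r) (j + 1) * profileFlux a r L (j + 1) ≤ 0 :=
    Finset.sum_nonpos fun j _ => by
      rw [mul_assoc]
      exact mul_nonpos_of_nonpos_of_nonneg
        (div_nonpos_of_nonpos_of_nonneg (by linarith) (by positivity))
        (mul_nonneg (gammaRatio_pos hθ (by omega)).le (profileFlux_nonneg ha r L _))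
  have hs : ∑ j ∈ Finset.range (K + 1),
      gammaRatio (a + 1 - r) (j + 1) * (risingFactor a r 0 * birthRate a j)
        ≤ risingFactor a r 0 * C1 * 2 := by
    calc _ ≤ ∑ j ∈ Finset.range (K + 1), risingFactor a r 0 * C1 * (1 / ((j : ℝ) + 1) ^ 2) := by
          refine Finset.sum_le_sum fun j _ => ?_
          calc _ = risingFactor a r 0 * (gammaRatio (a + 1 - r) (j + 1) * birthRate a j) := by ring
            _ ≤ risingFactor a r 0 * (C1 * (1 / ((j : ℝ) + 1) ^ r)) := 
            mul_le_mul_of_nonneg_left (h1 j) hf.le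
            _ ≤ risingFactor a r 0 * (C1 * (1 / ((j : ℝ) + 1) ^ 2)) := by
              gcongr
              linarith [(j.cast_nonneg : (0 : ℝ) ≤ j)]
            _ = _ := by ring
      _ ≤ _ := by
        rw [← Finset.mul_sum]
        gcongr
        exact sum_inv_sq_le K
  linarith

/-- The flux at order `r` is bounded by the moment of order `r + 1`; after multiplication by the
integrating factor its terms are `O(1 / j)` times the old logarithms, and the harmonic sum adds one
logarithm. -/
theorem profileMoment_descend {a : ℝ} (ha : 0 < a) {r i : ℕ} (hr1 : 1 ≤ r) (hr : (r : ℝ) ≤ a + 1)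
    (h : ∃ C : ℝ, 0 < C ∧ ∀ L K : ℕ, profileMoment a (r + 1) L (K + 1)
      ≤ C * (((K : ℝ) + 1) ^ (((r + 1 : ℕ) : ℝ) - a - 2) * posLog (K + 1) ^ i)) :
    ∃ C : ℝ, 0 < C ∧ ∀ L K : ℕ, profileMoment a r L (K + 1)
      ≤ C * (((K : ℝ) + 1) ^ ((r : ℝ) - a - 2) * posLog (K + 1) ^ (i + 1)) := by
  have hθ : -1 < a + 1 - r := by linarith
  obtain ⟨C0, hC0, h0⟩ := h
  obtain ⟨C1, hC1, h1⟩ := gammaRatio_mul_birthRate_le ha (show (r : ℝ) < a + 2 by linarith)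
  obtain ⟨C2, hC2, h2⟩ := le_of_gammaRatio_mul_le hθ
  obtain ⟨C3, hC3, h3⟩ := gammaRatio_order hθ
  have hf := risingFactor_pos ha r 0
  set C4 := risingFactor a r 0 * C1 * 2 ^ i + (a + 1 - r) * C3 * ((a + 1) * C0) with hC4
  have hC4' : 0 < C4 := by
    have : 0 ≤ a + 1 - (r : ℝ) := by linarith
    positivity
  refine ⟨C2 * (C4 * 3), by positivity, fun L K => ?_⟩
  have key := recursion_sum_by_parts hθ (m := profileMoment a r L) (g := profileFlux a r L)
    (s := fun k => risingFactor a r 0 * birthRate a k) (by simp [profileFlux, limitProfile])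
    (profileMoment_step ha r L) K
  have hl0 : 0 < posLog (K + 1) := by linarith [half_le_posLog (K + 1)]
  have hfinal := h2 K _ (C4 * 3 * posLog (K + 1) ^ (i + 1)) (profileMoment_nonneg ha r L (K + 1)) ?_
  · rw [show -(a + 1 - (r : ℝ)) - 1 = r - a - 2 by ring] at hfinal
    linarith
  have hflux := mul_nonneg (gammaRatio_pos hθ (show 1 ≤ K + 1 by omega)).le
    (profileFlux_nonneg ha r L (K + 1))
  have hs : ∑ j ∈ Finset.range (K + 1),
      gammaRatio (a + 1 - r) (j + 1) * (risingFactor a r 0 * birthRate a j)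
        ≤ ∑ j ∈ Finset.range (K + 1),
          risingFactor a r 0 * C1 * 2 ^ i * posLog (K + 1) ^ i * (1 / ((j : ℝ) + 1)) := by
    refine Finset.sum_le_sum fun j _ => ?_
    calc _ = risingFactor a r 0 * (gammaRatio (a + 1 - r) (j + 1) * birthRate a j) := by ring
      _ ≤ risingFactor a r 0 * (C1 * (1 / ((j : ℝ) + 1) ^ r)) := 
            mul_le_mul_of_nonneg_left (h1 j) hf.le
      _ ≤ risingFactor a r 0 * (C1 * (1 / ((j : ℝ) + 1))) := by
        gcongr
        exact le_self_pow₀ (by linarith [(j.cast_nonneg : (0 : ℝ) ≤ j)]) (by omega)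
      _ = risingFactor a r 0 * C1 * (1 / ((j : ℝ) + 1)) * 1 := by ring
      _ ≤ risingFactor a r 0 * C1 * (1 / ((j : ℝ) + 1)) * (2 ^ i * posLog (K + 1) ^ i) := by
        gcongr
        exact le_pow_posLog i
      _ = _ := by ring
  have hg : ∑ j ∈ Finset.range K,
      (a + 1 - r) / (j + 1) * gammaRatio (a + 1 - r) (j + 1) * profileFlux a r L (j + 1)
        ≤ ∑ j ∈ Finset.range (K + 1),
          (a + 1 - r) * C3 * ((a + 1) * C0) * posLog (K + 1) ^ i * (1 / ((j : ℝ) + 1)) := by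
    have hr0 : 0 ≤ a + 1 - (r : ℝ) := by linarith
    rw [Finset.sum_range_succ _ K]
    refine le_add_of_le_of_nonneg (Finset.sum_le_sum fun j hj => ?_) (by positivity)
    have hjp : (0 : ℝ) < j + 1 := by positivity
    have hv := (h3 (j + 1) (by omega)).1
    have hvp := gammaRatio_pos hθ (show 1 ≤ j + 1 by omega)
    push_cast at hv
    have hfl := profileFlux_nonneg ha r L (j + 1)
    have hj' : posLog (j + 1) ≤ posLog (K + 1) :=
      posLog_mono (by have := Finset.mem_range.1 hj; omega)
    have hj0 : 0 < posLog (j + 1) := by linarith [half_le_posLog (j + 1)]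
    have hm : profileFlux a r L (j + 1) ≤ (a + 1) * (C0 *
        (((j : ℝ) + 1) ^ (((r + 1 : ℕ) : ℝ) - a - 2) * posLog (K + 1) ^ i)) := by
      refine (profileFlux_le ha r L (j + 1)).trans ?_
      gcongr
      refine (h0 L j).trans ?_
      gcongr
    calc _ ≤ (a + 1 - r) / (j + 1) * (C3 * ((j : ℝ) + 1) ^ (a + 1 - (r : ℝ))) * ((a + 1) * (C0 *
        (((j : ℝ) + 1) ^ (((r + 1 : ℕ) : ℝ) - a - 2) * posLog (K + 1) ^ i))) := by gcongr
      _ = (a + 1 - r) * C3 * ((a + 1) * C0) * posLog (K + 1) ^ i * (1 / ((j : ℝ) + 1))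
          * (((j : ℝ) + 1) ^ (a + 1 - (r : ℝ)) * ((j : ℝ) + 1) ^ (((r + 1 : ℕ) : ℝ) - a - 2)) := by
        ring
      _ = _ := by
        -- The powers of `j + 1` cancel, leaving only the factor `1 / (j + 1)`.
        rw [← Real.rpow_add hjp]
        push_cast
        rw [show a + 1 - (r : ℝ) + (r + 1 - a - 2) = 0 by ring, Real.rpow_zero, mul_one]
  rw [← Finset.mul_sum] at hs hg
  have hsum := sum_inv_le_posLog K
  have htot : C4 * posLog (K + 1) ^ i * ∑ j ∈ Finset.range (K + 1), 1 / ((j : ℝ) + 1)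
      ≤ C4 * posLog (K + 1) ^ i * (3 * posLog (K + 1)) := by gcongr
  have e : C4 * posLog (K + 1) ^ i * (3 * posLog (K + 1))
      = C4 * 3 * posLog (K + 1) ^ (i + 1) := by ring
  rw [e] at htot
  refine le_trans ?_ htot
  rw [hC4]
  linarith

/-- Start at order `⌈a⌉₊ + 1`, the integer in `[a + 1, a + 2)`, and descend `⌈a⌉₊` times. -/
theorem profileMoment_one_le {a : ℝ} (ha : 0 < a) :
    ∃ C : ℝ, 0 < C ∧ ∀ L K : ℕ, profileMoment a 1 L (K + 1)
      ≤ C * (((K : ℝ) + 1) ^ (-(a + 1)) * posLog (K + 1) ^ ⌈a⌉₊) := by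
  have h1 : 1 ≤ ⌈a⌉₊ := Nat.one_le_ceil_iff.2 ha
  have key : ∀ i : ℕ, i ≤ ⌈a⌉₊ → ∃ C : ℝ, 0 < C ∧ ∀ L K : ℕ,
      profileMoment a (⌈a⌉₊ + 1 - i) L (K + 1)
        ≤ C * (((K : ℝ) + 1) ^ (((⌈a⌉₊ + 1 - i : ℕ) : ℝ) - a - 2) * posLog (K + 1) ^ i) := by
    intro i
    induction i with
    | zero =>
      intro _
      have := Nat.le_ceil a
      have := Nat.ceil_lt_add_one ha.le
      simpa using profileMoment_top ha (r := ⌈a⌉₊ + 1) (by omega) (by push_cast; linarith)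
        (by push_cast; linarith)
    | succ i ih =>
      intro hi
      refine profileMoment_descend ha (r := ⌈a⌉₊ + 1 - (i + 1)) (by omega) ?_ ?_
      · have := Nat.ceil_lt_add_one ha.le
        have h2 : ((⌈a⌉₊ + 1 - (i + 1) : ℕ) : ℝ) ≤ (⌈a⌉₊ : ℝ) := by
          exact_mod_cast (show ⌈a⌉₊ + 1 - (i + 1) ≤ ⌈a⌉₊ by omega)
        linarith
      · rw [show ⌈a⌉₊ + 1 - (i + 1) + 1 = ⌈a⌉₊ + 1 - i by omega]
        exact ih (by omega)
  have := key ⌈a⌉₊ le_rfl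
  rw [show ⌈a⌉₊ + 1 - ⌈a⌉₊ = 1 by omega] at this
  rwa [show ((1 : ℕ) : ℝ) - a - 2 = -(a + 1) by push_cast; ring] at this

/-! ### Asymptotics of the limiting second degree law -/

theorem summable_children_mul_limitProfile {a : ℝ} (ha : 0 < a) (k : ℕ) :
    Summable fun l : ℕ => ((l : ℝ) + a) * limitProfile a k l := by
  cases k with
  | zero => simp [limitProfile]
  | succ K =>
    obtain ⟨C, hC, h⟩ := profileMoment_one_le ha
    refine summable_of_sum_range_le (fun l => mul_nonneg (by positivity)
      (limitProfile_nonneg ha _ _)) (fun L => ?_) (c := C * (((K : ℝ) + 1) ^ (-(a + 1))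
        * posLog (K + 1) ^ ⌈a⌉₊))
    simpa [profileMoment, risingFactor] using h L K

theorem summable_limitProfile {a : ℝ} (ha : 0 < a) (k : ℕ) :
    Summable fun l : ℕ => limitProfile a k l := by
  refine Summable.of_nonneg_of_le (fun l => limitProfile_nonneg ha k l) (fun l => ?_)
    ((summable_children_mul_limitProfile ha k).mul_left (1 / a))
  have := limitProfile_nonneg ha k l
  rw [← mul_assoc]
  refine le_mul_of_one_le_left this ?_
  rw [one_div, inv_mul_eq_div, one_le_div ha]
  linarith [(l.cast_nonneg : (0 : ℝ) ≤ l)]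

theorem summable_flux_limitProfile {a : ℝ} (ha : 0 < a) (k : ℕ) :
    Summable fun l : ℕ => (a * l + a) * limitProfile a k l := by
  refine ((summable_children_mul_limitProfile ha k).mul_left a |>.add
    ((summable_limitProfile ha k).mul_left (a - a * a))).congr fun l => ?_
  ring

/-- The limiting proportion of vertices with second degree `k`. -/
noncomputable def limitSecond (a : ℝ) (k : ℕ) : ℝ := ∑' l, limitProfile a k l

/-- The limiting value of `a` times the number of neighbours, on second degree `k`. -/
noncomputable def limitFlux (a : ℝ) (k : ℕ) : ℝ := ∑' l : ℕ, (a * l + a) * limitProfile a k l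

theorem limitFlux_nonneg {a : ℝ} (ha : 0 < a) (k : ℕ) : 0 ≤ limitFlux a k :=
  tsum_nonneg fun l => mul_nonneg (by positivity) (limitProfile_nonneg ha k l)

theorem limitSecond_nonneg {a : ℝ} (ha : 0 < a) (k : ℕ) : 0 ≤ limitSecond a k :=
  tsum_nonneg fun l => limitProfile_nonneg ha k l

theorem limitFlux_le {a : ℝ} (ha : 0 < a) :
    ∃ C : ℝ, 0 < C ∧ ∀ K : ℕ,
      limitFlux a (K + 1) ≤ C * (((K : ℝ) + 1) ^ (-(a + 1)) * posLog (K + 1) ^ ⌈a⌉₊) := by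
  obtain ⟨C, hC, h⟩ := profileMoment_one_le ha
  refine ⟨(a + 1) * C, by positivity, fun K => ?_⟩
  refine (summable_flux_limitProfile ha (K + 1)).tsum_le_of_sum_range_le fun L => ?_
  have h1 := profileFlux_le ha 0 L (K + 1)
  have h2 := mul_le_mul_of_nonneg_left (h L K) (show 0 ≤ a + 1 by positivity)
  simp only [profileFlux, risingFactor, one_mul] at h1
  rw [mul_assoc]
  exact h1.trans h2

/-- The balance of order zero as the cutoff tends to infinity; the cutoff term vanishes because it
is the general term of a convergent series. -/
theorem limitSecond_balance {a : ℝ} (ha : 0 < a) (k : ℕ) :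
    (k + 1 + (a + 1)) * limitSecond a (k + 1) + limitFlux a (k + 1)
      = k * limitSecond a k + limitFlux a k + birthRate a k := by
  have hs : ∀ j, Tendsto (fun L => profileMoment a 0 (L + 1) j) atTop (𝓝 (limitSecond a j)) := by
    intro j
    have := (summable_limitProfile ha j).hasSum.tendsto_sum_nat
    simpa [profileMoment, risingFactor, limitSecond] using (tendsto_add_atTop_iff_nat 1).2 this
  have hf : ∀ j, Tendsto (fun L => profileFlux a 0 (L + 1) j) atTop (𝓝 (limitFlux a j)) := by
    intro j
    have := (summable_flux_limitProfile ha j).hasSum.tendsto_sum_nat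
    simpa [profileFlux, risingFactor, limitFlux] using (tendsto_add_atTop_iff_nat 1).2 this
  have hb : Tendsto (fun L : ℕ => risingFactor a 0 (L + 1) * (L + a) * limitProfile a (k + 1) L)
      atTop (𝓝 0) := by
    simpa [risingFactor] using (summable_children_mul_limitProfile ha (k + 1)).tendsto_atTop_zero
  have h1 := (((hs (k + 1)).const_mul ((k : ℝ) + 1 + (a + 1))).add (hf (k + 1))).add hb
  have h2 := (((hs k).const_mul (k : ℝ)).add (hf k)).add_const (birthRate a k)
  rw [add_zero] at h1
  refine tendsto_nhds_unique h1 (h2.congr fun L => ?_)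
  have := profileMoment_balance ha 0 L k
  simp only [Nat.cast_zero, sub_zero, show risingFactor a 0 0 = 1 from rfl, one_mul] at this ⊢
  linarith

/-- The exponents `a + 1`, `a` and `-(2 * a + 1)` cancel, so each term is `limitConst a * (1 + O(1 /
j))`. This sum is the origin of the main term. -/
theorem sum_gammaRatio_mul_birthRate {a : ℝ} (ha : 0 < a) :
    ∃ C : ℝ, 0 ≤ C ∧ ∀ K : ℕ,
      |∑ j ∈ Finset.range (K + 1), gammaRatio (a + 1) (j + 1) * birthRate a j
        - limitConst a * (K + 1)| ≤ C * posLog (K + 1) := by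
  obtain ⟨C, hC, h⟩ := ((nearOne_gammaRatio (show -1 < a + 1 by linarith)).1.mul
    (nearOne_gammaRatio (show -1 < a by linarith)).1).mul
    (nearOne_gammaRatio (show -1 < 2 * a + 1 by linarith)).2
  have hA := limitConst_pos ha
  refine ⟨limitConst a * C * 3, by positivity, fun K => ?_⟩
  have hterm : ∀ j : ℕ, |gammaRatio (a + 1) (j + 1) * birthRate a j - limitConst a|
      ≤ limitConst a * C * (1 / ((j : ℝ) + 1)) := by
    intro j
    have hj : (0 : ℝ) < j + 1 := by positivity
    have hj1 := h (j + 1) (by omega)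
    have hg := gammaRatio_pos (show -1 < 2 * a + 1 by linarith) (show 1 ≤ j + 1 by omega)
    push_cast at hj1
    have e : gammaRatio (a + 1) (j + 1) / ((j : ℝ) + 1) ^ (a + 1)
          * (gammaRatio a (j + 1) / ((j : ℝ) + 1) ^ a)
          * (((j : ℝ) + 1) ^ (2 * a + 1) / gammaRatio (2 * a + 1) (j + 1))
        = gammaRatio (a + 1) (j + 1) * (gammaRatio a (j + 1) / gammaRatio (2 * a + 1) (j + 1)) := by
      have hp : ((j : ℝ) + 1) ^ (2 * a + 1) = ((j : ℝ) + 1) ^ (a + 1) * ((j : ℝ) + 1) ^ a := by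
        rw [← Real.rpow_add hj]
        ring_nf
      have h1 : ((j : ℝ) + 1) ^ a ≠ 0 := by positivity
      have h2 : ((j : ℝ) + 1) ^ (a + 1) ≠ 0 := by positivity
      rw [hp]
      generalize ((j : ℝ) + 1) ^ a = x at h1 ⊢
      generalize ((j : ℝ) + 1) ^ (a + 1) = y at h2 ⊢
      field_simp
    rw [e] at hj1
    rw [birthRate_eq ha, show gammaRatio (a + 1) (j + 1) * (limitConst a *
      (gammaRatio a (j + 1) / gammaRatio (2 * a + 1) (j + 1))) - limitConst a
      = limitConst a * (gammaRatio (a + 1) (j + 1) *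
      (gammaRatio a (j + 1) / gammaRatio (2 * a + 1) (j + 1)) - 1) by ring, abs_mul, abs_of_pos hA]
    calc _ ≤ limitConst a * (C / (j + 1)) := by gcongr
      _ = _ := by ring
  have e : ∑ j ∈ Finset.range (K + 1), gammaRatio (a + 1) (j + 1) * birthRate a j
        - limitConst a * (K + 1)
      = ∑ j ∈ Finset.range (K + 1), (gammaRatio (a + 1) (j + 1) * birthRate a j - limitConst a) := by
    rw [Finset.sum_sub_distrib]
    simp
    ring
  rw [e]
  calc _ ≤ ∑ j ∈ Finset.range (K + 1), limitConst a * C * (1 / ((j : ℝ) + 1)) :=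
        (Finset.abs_sum_le_sum_abs _ _).trans (Finset.sum_le_sum fun j _ => hterm j)
    _ = limitConst a * C * ∑ j ∈ Finset.range (K + 1), 1 / ((j : ℝ) + 1) := by rw [Finset.mul_sum]
    _ ≤ limitConst a * C * (3 * posLog (K + 1)) := by gcongr; exact sum_inv_le_posLog K
    _ = _ := by ring

/-- Summation by parts with `θ = a + 1`: the source sum gives the main term, while the weighted flux
is a power of the logarithm at the endpoint and a harmonic sum of such powers inside. -/
theorem gammaRatio_mul_limitSecond {a : ℝ} (ha : 0 < a) :
    ∃ C : ℝ, 0 ≤ C ∧ ∀ K : ℕ,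
      |gammaRatio (a + 2) (K + 1) * limitSecond a (K + 1) - limitConst a * (K + 1)|
        ≤ C * posLog (K + 1) ^ (⌈a⌉₊ + 1) := by
  obtain ⟨C1, hC1, h1⟩ := sum_gammaRatio_mul_birthRate ha
  obtain ⟨C2, hC2, h2⟩ := limitFlux_le ha
  have hθ : -1 < a + 1 := by linarith
  obtain ⟨C3, hC3, h3⟩ := gammaRatio_order hθ
  refine ⟨C1 * 2 ^ ⌈a⌉₊ + 2 * (C3 * C2) + (a + 1) * (C3 * C2) * 3, by positivity, fun K => ?_⟩
  have key := recursion_sum_by_parts_eq hθ (m := limitSecond a) (g := limitFlux a)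
    (s := birthRate a) (by simp [limitFlux, limitProfile]) (limitSecond_balance ha) K
  have e := gammaRatio_add_one hθ (show 1 ≤ K + 1 by omega)
  rw [show a + 1 + 1 = a + 2 by ring] at e
  push_cast at e
  rw [← e] at key
  have hl0 : 1 / 2 ≤ posLog (K + 1) := half_le_posLog (K + 1)
  have hlp : 0 < posLog (K + 1) := by linarith
  have hflux : ∀ j ≤ K, gammaRatio (a + 1) (j + 1) * limitFlux a (j + 1)
      ≤ C3 * C2 * posLog (K + 1) ^ ⌈a⌉₊ := by
    intro j hj
    have hjp : (0 : ℝ) < j + 1 := by positivity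
    have hv := (h3 (j + 1) (by omega)).1
    have hvp := gammaRatio_pos hθ (show 1 ≤ j + 1 by omega)
    have hf := limitFlux_nonneg ha (j + 1)
    have hj' : posLog (j + 1) ≤ posLog (K + 1) := posLog_mono (by omega)
    have hj0 : 0 < posLog (j + 1) := by linarith [half_le_posLog (j + 1)]
    push_cast at hv
    calc _ ≤ (C3 * ((j : ℝ) + 1) ^ (a + 1))
          * (C2 * (((j : ℝ) + 1) ^ (-(a + 1)) * posLog (K + 1) ^ ⌈a⌉₊)) := by
          gcongr
          refine (h2 j).trans ?_
          gcongr
      _ = C3 * C2 * posLog (K + 1) ^ ⌈a⌉₊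
          * (((j : ℝ) + 1) ^ (a + 1) * ((j : ℝ) + 1) ^ (-(a + 1))) := by ring
      _ = _ := by rw [← Real.rpow_add hjp]; simp
  have hfirst := hflux K le_rfl
  have hfirst0 : 0 ≤ gammaRatio (a + 1) (K + 1) * limitFlux a (K + 1) :=
    mul_nonneg (gammaRatio_pos hθ (by omega)).le (limitFlux_nonneg ha _)
  have hsum0 : 0 ≤ ∑ j ∈ Finset.range K,
      (a + 1) / (j + 1) * gammaRatio (a + 1) (j + 1) * limitFlux a (j + 1) :=
    Finset.sum_nonneg fun j _ => mul_nonneg (mul_nonneg (by positivity)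
      (gammaRatio_pos hθ (by omega)).le) (limitFlux_nonneg ha _)
  have hsum : ∑ j ∈ Finset.range K,
      (a + 1) / (j + 1) * gammaRatio (a + 1) (j + 1) * limitFlux a (j + 1)
        ≤ (a + 1) * (C3 * C2) * 3 * posLog (K + 1) ^ (⌈a⌉₊ + 1) := by
    calc _ ≤ ∑ j ∈ Finset.range (K + 1),
          (a + 1) * (C3 * C2 * posLog (K + 1) ^ ⌈a⌉₊) * (1 / ((j : ℝ) + 1)) := by
          rw [Finset.sum_range_succ _ K]
          refine le_add_of_le_of_nonneg (Finset.sum_le_sum fun j hj => ?_) (by positivity)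
          have := hflux j (Finset.mem_range.1 hj).le
          calc _ = (a + 1) / (j + 1) * (gammaRatio (a + 1) (j + 1) * limitFlux a (j + 1)) := by ring
            _ ≤ (a + 1) / (j + 1) * (C3 * C2 * posLog (K + 1) ^ ⌈a⌉₊) := by gcongr
            _ = _ := by ring
      _ = (a + 1) * (C3 * C2 * posLog (K + 1) ^ ⌈a⌉₊)
          * ∑ j ∈ Finset.range (K + 1), 1 / ((j : ℝ) + 1) := by rw [Finset.mul_sum]
      _ ≤ (a + 1) * (C3 * C2 * posLog (K + 1) ^ ⌈a⌉₊) * (3 * posLog (K + 1)) := by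
        gcongr
        exact sum_inv_le_posLog K
      _ = _ := by ring
  have hfirst' : gammaRatio (a + 1) (K + 1) * limitFlux a (K + 1)
      ≤ 2 * (C3 * C2) * posLog (K + 1) ^ (⌈a⌉₊ + 1) := by
    refine hfirst.trans ?_
    rw [← mul_one (C3 * C2 * posLog (K + 1) ^ ⌈a⌉₊)]
    calc C3 * C2 * posLog (K + 1) ^ ⌈a⌉₊ * 1
        ≤ C3 * C2 * posLog (K + 1) ^ ⌈a⌉₊ * (2 * posLog (K + 1)) := by
          gcongr
          linarith
      _ = _ := by ring
  have hb : |∑ j ∈ Finset.range (K + 1), gammaRatio (a + 1) (j + 1) * birthRate a j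
        - limitConst a * (K + 1)| ≤ C1 * 2 ^ ⌈a⌉₊ * posLog (K + 1) ^ (⌈a⌉₊ + 1) := by
    refine (h1 K).trans ?_
    rw [← mul_one (C1 * posLog (K + 1))]
    calc C1 * posLog (K + 1) * 1 ≤ C1 * posLog (K + 1) * (2 ^ ⌈a⌉₊ * posLog (K + 1) ^ ⌈a⌉₊) := by
          gcongr
          exact le_pow_posLog _
      _ = _ := by ring
  rw [abs_le] at hb ⊢
  constructor <;> linarith [hb.1, hb.2]

/-- The asymptotic behaviour of the limiting second degree distribution. -/
theorem limitSecond_asymptotic {a : ℝ} (ha : 0 < a) :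
    ∃ C : ℝ, 0 ≤ C ∧ ∀ k : ℕ, 1 ≤ k →
      |limitSecond a k * (k : ℝ) ^ (a + 1) / limitConst a - 1|
        ≤ C * (posLog k ^ (⌈a⌉₊ + 1) / k) := by
  obtain ⟨C1, hC1, h1⟩ := gammaRatio_mul_limitSecond ha
  have hθ : -1 < a + 2 := by linarith
  obtain ⟨C2, hC2, h2⟩ := (nearOne_gammaRatio hθ).2
  obtain ⟨C3, hC3, h3⟩ := (nearOne_gammaRatio hθ).2.bounded
  have hA := limitConst_pos ha
  refine ⟨C2 * 2 ^ (⌈a⌉₊ + 1) + C3 * (C1 / limitConst a), by positivity, fun k hk => ?_⟩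
  have hk0 : (0 : ℝ) < k := by exact_mod_cast hk
  have hl0 : 1 / 2 ≤ posLog k := half_le_posLog k
  have h1 := h1 (k - 1)
  rw [show ((k - 1 : ℕ) : ℝ) + 1 = k by rw [Nat.cast_sub hk]; simp,
    show k - 1 + 1 = k by omega] at h1
  have hg := gammaRatio_pos hθ hk
  set q := (k : ℝ) ^ (a + 2) / gammaRatio (a + 2) k with hq
  set E := gammaRatio (a + 2) k * limitSecond a k - limitConst a * k with hE
  have e : limitSecond a k * (k : ℝ) ^ (a + 1) / limitConst a - 1
      = (q - 1) + q * (E / (limitConst a * k)) := by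
    have hp : (k : ℝ) ^ (a + 2) = (k : ℝ) ^ (a + 1) * k := by
      rw [← Real.rpow_add_one hk0.ne']
      ring_nf
    rw [hq, hE, hp]
    generalize (k : ℝ) ^ (a + 1) = x
    field_simp
    ring
  have hb1 : |q - 1| ≤ C2 * 2 ^ (⌈a⌉₊ + 1) * (posLog k ^ (⌈a⌉₊ + 1) / k) := by
    refine (h2 k hk).trans ?_
    calc C2 / (k : ℝ) = C2 / k * 1 := by ring
      _ ≤ C2 / k * (2 ^ (⌈a⌉₊ + 1) * posLog k ^ (⌈a⌉₊ + 1)) := by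
        gcongr
        exact le_pow_posLog _
      _ = _ := by ring
  have hb2 : |q * (E / (limitConst a * k))|
      ≤ C3 * (C1 / limitConst a) * (posLog k ^ (⌈a⌉₊ + 1) / k) := by
    rw [abs_mul, abs_div E, abs_of_pos (show 0 < limitConst a * k by positivity)]
    calc _ ≤ C3 * (C1 * posLog k ^ (⌈a⌉₊ + 1) / (limitConst a * k)) := by
          gcongr
          exact h3 k hk
      _ = _ := by field_simp
  rw [e]
  refine (abs_add_le _ _).trans ?_
  linarith

/-! ### Supersolutions for the error recursions -/

/-- The normalizing factor of the attachment probabilities, when `n` vertices are present. -/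
noncomputable def stepDenom (a : ℝ) (n : ℕ) : ℝ := (a + 1) * ((n : ℝ) + 1) - 1

theorem stepDenom_pos {a : ℝ} (ha : 0 < a) (n : ℕ) : 0 < stepDenom a n :=
  BuckleyOsthus.denom_pos ha n

theorem stepDenom_succ (a : ℝ) (n : ℕ) : stepDenom a (n + 1) = stepDenom a n + (a + 1) := by
  unfold stepDenom
  push_cast
  ring

/-- A supersolution bound for a pure birth recursion with births of rate `O(1 / n)`. -/
theorem degree_error_le {a α C : ℝ} (ha : 0 < a) (hα : 0 < α) {M : ℕ}
    {E : ℕ → ℕ → ℝ} (h0 : ∀ j, |E M j| ≤ C / (j + α))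
    (hbig : ∀ n, M ≤ n → ∀ j : ℕ, stepDenom a n < j + α → |E (n + 1) j| ≤ C / (j + α))
    (hrec : ∀ n, M ≤ n → ∀ j : ℕ, j + α ≤ stepDenom a n →
      |E (n + 1) j| ≤ (1 - (j + α) / stepDenom a n) * |E n j|
        + (if j = 0 then C else (j - 1 + α) * |E n (j - 1)|) / stepDenom a n)
    {n : ℕ} (hn : M ≤ n) (j : ℕ) : |E n j| ≤ C / (j + α) := by
  induction n, hn using Nat.le_induction generalizing j with
  | base => exact h0 j
  | succ n hn ih =>
    rcases lt_or_ge (stepDenom a n) (j + α) with h | h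
    · exact hbig n hn j h
    have hD := stepDenom_pos ha n
    have hc : 0 ≤ 1 - (j + α) / stepDenom a n := by
      rw [sub_nonneg, div_le_one hD]; exact h
    have hj : 0 < (j : ℝ) + α := by positivity
    have hU : (if j = 0 then C else (j - 1 + α) * |E n (j - 1)|) ≤ C := by
      split_ifs with hj0
      · exact le_rfl
      · have h1 := ih (j - 1)
        rw [Nat.cast_sub (by omega), Nat.cast_one, le_div_iff₀] at h1
        · linarith
        · have : (1 : ℝ) ≤ j := by exact_mod_cast Nat.one_le_iff_ne_zero.2 hj0
          linarith
    -- The inflow bounded by `C` exactly replaces the outflow, since `(j + α) * (C / (j + α)) = C`.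
    calc _ ≤ _ := hrec n hn j h
      _ ≤ (1 - (j + α) / stepDenom a n) * (C / (j + α)) + C / stepDenom a n := by
        gcongr
        exact ih j
      _ = _ := by field_simp; ring

/-- A supersolution bound, uniform in the second coordinate, for a birth process with two
coordinates and births of rate `O(1 / n)` at every level of the second coordinate. -/
theorem profile_error_le {a α β K : ℝ} (ha : 0 < a) (hα : 0 < α) (hβ : 0 ≤ β) (hK : 0 ≤ K) {M : ℕ}
    {E : ℕ → ℕ → ℕ → ℝ} (h0 : ∀ l k, |E M l k| ≤ K / ((l + α) * (l + α + 1)))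
    (hsmall : ∀ n, M ≤ n → ∀ l : ℕ, a * l < 1 → |E n l 0| ≤ K / ((l + α) * (l + α + 1)))
    (hbig : ∀ n, M ≤ n → ∀ l k : ℕ, stepDenom a n < l + α + (k + β + a * l) →
      |E (n + 1) l k| ≤ K / ((l + α) * (l + α + 1)))
    (hrec : ∀ n, M ≤ n → ∀ l k : ℕ, l + α + (k + β + a * l) ≤ stepDenom a n →
      |E (n + 1) l k| ≤ (1 - (l + α + (k + β + a * l)) / stepDenom a n) * |E n l k|
        + (if l = 0 then K / α else (l - 1 + α) * |E n (l - 1) k|) / stepDenom a n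
        + (if k = 0 then 0 else (k - 1 + β + a * l) * |E n l (k - 1)|) / stepDenom a n)
    {n : ℕ} (hn : M ≤ n) (l k : ℕ) : |E n l k| ≤ K / ((l + α) * (l + α + 1)) := by
  induction n, hn using Nat.le_induction generalizing l k with
  | base => exact h0 l k
  | succ n hn ih =>
    rcases lt_or_ge (stepDenom a n) (l + α + (k + β + a * l)) with h | h
    · exact hbig n hn l k h
    -- For `k = 0` there is no inflow in `k`, and bounding zero by `(k - 1 + β + a * l) * F` needs
    -- this factor to be nonnegative. It can be negative only when `a * l < 1`, which is why that
    -- case is a separate hypothesis.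
    by_cases hs : k = 0 ∧ a * l < 1
    · rw [hs.1]
      exact hsmall (n + 1) (by omega) l hs.2
    have hD := stepDenom_pos ha n
    have hl : 0 < (l : ℝ) + α := by positivity
    set F := K / ((l + α) * (l + α + 1)) with hF
    have hF0 : 0 ≤ F := by positivity
    have hc : 0 ≤ 1 - (l + α + (k + β + a * l)) / stepDenom a n := by
      rw [sub_nonneg, div_le_one hD]; exact h
    have hU : (if l = 0 then K / α else (l - 1 + α) * |E n (l - 1) k|) ≤ (l + α + 1) * F := by
      split_ifs with hl0
      · subst hl0
        rw [hF, Nat.cast_zero, zero_add]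
        refine le_of_eq ?_
        field_simp
      · have h1 := ih (l - 1) k
        have hl1 : (1 : ℝ) ≤ l := by exact_mod_cast Nat.one_le_iff_ne_zero.2 hl0
        have hp : 0 < (l : ℝ) - 1 + α := by linarith
        rw [Nat.cast_sub (by omega), Nat.cast_one] at h1
        calc _ ≤ ((l : ℝ) - 1 + α) * (K / ((l - 1 + α) * (l - 1 + α + 1))) := by gcongr
          _ = _ := by
            rw [hF, show (l : ℝ) - 1 + α + 1 = l + α by ring]
            field_simp
    have hV : (if k = 0 then 0 else (k - 1 + β + a * l) * |E n l (k - 1)|)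
        ≤ (k - 1 + β + a * l) * F := by
      split_ifs with hk0
      · subst hk0
        have : 1 ≤ a * (l : ℝ) := by
          by_contra hcon
          exact hs ⟨rfl, not_le.1 hcon⟩
        refine mul_nonneg ?_ hF0
        rw [Nat.cast_zero]
        linarith
      · have h1 : (1 : ℝ) ≤ k := by exact_mod_cast Nat.one_le_iff_ne_zero.2 hk0
        have : 0 ≤ a * (l : ℝ) := by positivity
        refine mul_le_mul_of_nonneg_left (ih l (k - 1)) ?_
        linarith
    -- The drift in `l` gains `F / stepDenom a n` and the drift in `k` loses the same amount.
    calc _ ≤ _ := hrec n hn l k h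
      _ ≤ (1 - (l + α + (k + β + a * l)) / stepDenom a n) * F + (l + α + 1) * F / stepDenom a n
          + (k - 1 + β + a * l) * F / stepDenom a n := by
        gcongr
        exact ih l k
      _ = F := by field_simp; ring

/-- A telescoping sum, bounded uniformly in `L`; it lets the errors be added over all numbers of
children. -/
theorem sum_inv_mul_le {α : ℝ} (hα : 0 < α) (L : ℕ) :
    ∑ l ∈ Finset.range L, 1 / (((l : ℝ) + α) * (l + α + 1)) ≤ 1 / α := by
  have key : ∑ l ∈ Finset.range L, 1 / (((l : ℝ) + α) * (l + α + 1)) = 1 / α - 1 / (L + α) := by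
    induction L with
    | zero => simp
    | succ L ih =>
      rw [Finset.sum_range_succ, ih]
      push_cast
      have h1 : (L : ℝ) + α ≠ 0 := by positivity
      have h2 : (L : ℝ) + α + 1 ≠ 0 := by positivity
      have h3 : (L : ℝ) + 1 + α ≠ 0 := by positivity
      field_simp
      ring
  have : 0 ≤ 1 / ((L : ℝ) + α) := by positivity
  linarith

/-! ### Degrees and second degrees under one step of the process -/

open BuckleyOsthus

namespace EdgeMap

variable {n : ℕ}

@[simp] theorem extend_castSucc (f : EdgeMap n) (s : Fin (n + 1)) (i : Fin n) :
    f.extend s i.castSucc = (f i).castSucc := by simp [extend]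

@[simp] theorem extend_last (f : EdgeMap n) (s : Fin (n + 1)) : f.extend s (Fin.last n) = s := by
  simp [extend]

/-- The graphs that the process can produce. -/
inductive Reachable : (n : ℕ) → EdgeMap n → Prop
  | empty (f : EdgeMap 0) : Reachable 0 f
  | extend {n : ℕ} {f : EdgeMap n} (s : Fin (n + 1)) : Reachable n f → Reachable (n + 1) (f.extend s)

theorem Reachable.apply_le {f : EdgeMap n} (h : Reachable n f) (i : Fin n) : f i ≤ i := by
  induction h with
  | empty f => exact i.elim0
  | extend s _ ih =>
    induction i using Fin.lastCases with
    | last => exact Fin.le_last _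
    | cast i => simpa using ih i

/-- The number of edges that were sent to the vertex `t`. -/
def inDegree (f : EdgeMap n) (t : Fin n) : ℕ := ∑ i, if f i = t then 1 else 0

theorem degree_eq (f : EdgeMap n) (t : Fin n) : f.degree t = f.inDegree t + 1 := by
  simp [degree, inDegree, Finset.sum_add_distrib, add_comm]

theorem inDegree_extend_castSucc (f : EdgeMap n) (s : Fin (n + 1)) (t : Fin n) :
    (f.extend s).inDegree t.castSucc = f.inDegree t + if s = t.castSucc then 1 else 0 := by
  unfold inDegree
  rw [Fin.sum_univ_castSucc]
  simp [-Finset.sum_boole]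

theorem inDegree_extend_last (f : EdgeMap n) (s : Fin (n + 1)) :
    (f.extend s).inDegree (Fin.last n) = if s = Fin.last n then 1 else 0 := by
  have : ∀ i : Fin n, (f i).castSucc ≠ Fin.last n := fun i => (Fin.castSucc_lt_last _).ne
  unfold inDegree
  rw [Fin.sum_univ_castSucc]
  simp [-Finset.sum_boole, this]

theorem inDegree_le (f : EdgeMap n) (t : Fin n) : f.inDegree t ≤ n := by
  unfold inDegree
  calc _ ≤ ∑ _i : Fin n, 1 := Finset.sum_le_sum fun i _ => by split_ifs <;> simp
    _ = n := by simp

theorem one_le_inDegree_of_loop {f : EdgeMap n} {t : Fin n} (h : f t = t) : 1 ≤ f.inDegree t := by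
  unfold inDegree
  refine le_trans ?_ (Finset.single_le_sum (fun i _ => Nat.zero_le _) (Finset.mem_univ t))
  simp [h]

/-- Two different vertices joined by an edge. -/
def Adjacent (f : EdgeMap n) (t s : Fin n) : Prop := s ≠ t ∧ (f t = s ∨ f s = t)

instance (f : EdgeMap n) (t s : Fin n) : Decidable (f.Adjacent t s) := by
  unfold Adjacent; infer_instance

theorem exists_edge_eq_iff (f : EdgeMap n) (t u : Fin n) :
    (∃ j : Fin n, f.edge j = s(t, u)) ↔ f t = u ∨ f u = t := by
  simp only [edge, Sym2.eq_iff]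
  constructor
  · rintro ⟨j, ⟨rfl, h⟩ | ⟨rfl, h⟩⟩
    · exact Or.inl h
    · exact Or.inr h
  · rintro (h | h)
    · exact ⟨t, Or.inl ⟨rfl, h⟩⟩
    · exact ⟨u, Or.inr ⟨rfl, h⟩⟩

theorem secondDegree_eq_sum (f : EdgeMap n) (t : Fin n) :
    f.secondDegree t
      = ∑ i, if t ≠ i ∧ t ≠ f i ∧ (f t = i ∨ f t = f i ∨ f (f i) = t) then 1 else 0 := by
  classical
  rw [secondDegree, Finset.card_filter]
  refine Finset.sum_congr rfl fun i _ => ?_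
  congr 1
  simp only [exists_edge_eq_iff]
  simp only [edge, Sym2.mem_iff, eq_iff_iff, not_or]
  constructor
  · rintro ⟨⟨h1, h2⟩, u, rfl | rfl, h | h⟩
    · exact ⟨h1, h2, Or.inl h⟩
    · exact absurd h.symm h2
    · exact ⟨h1, h2, Or.inr (Or.inl h)⟩
    · exact ⟨h1, h2, Or.inr (Or.inr h)⟩
  · rintro ⟨h1, h2, h | h | h⟩
    · exact ⟨⟨h1, h2⟩, i, Or.inl rfl, Or.inl h⟩
    · exact ⟨⟨h1, h2⟩, f i, Or.inr rfl, Or.inl h⟩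
    · exact ⟨⟨h1, h2⟩, f i, Or.inr rfl, Or.inr h⟩

theorem secondDegree_extend_self (f : EdgeMap n) (t : Fin n) :
    (f.extend (Fin.last n)).secondDegree t.castSucc = f.secondDegree t := by
  have h1 : ∀ i : Fin n, i.castSucc ≠ Fin.last n := fun i => (Fin.castSucc_lt_last _).ne
  have h2 : ∀ i : Fin n, Fin.last n ≠ i.castSucc := fun i => (h1 i).symm
  rw [secondDegree_eq_sum, Fin.sum_univ_castSucc]
  simp [-Finset.sum_boole, secondDegree_eq_sum, h1, h2]

theorem secondDegree_extend_castSucc (f : EdgeMap n) (s t : Fin n) :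
    (f.extend s.castSucc).secondDegree t.castSucc
      = f.secondDegree t + if f.Adjacent t s then 1 else 0 := by
  have h1 : ∀ i : Fin n, i.castSucc ≠ Fin.last n := fun i => (Fin.castSucc_lt_last _).ne
  rw [secondDegree_eq_sum, Fin.sum_univ_castSucc]
  simp [-Finset.sum_boole, secondDegree_eq_sum, h1, Adjacent, eq_comm (a := t)]

theorem secondDegree_extend_last_self (f : EdgeMap n) :
    (f.extend (Fin.last n)).secondDegree (Fin.last n) = 0 := by
  have h1 : ∀ i : Fin n, i.castSucc ≠ Fin.last n := fun i => (Fin.castSucc_lt_last _).ne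
  have h2 : ∀ i : Fin n, Fin.last n ≠ i.castSucc := fun i => (h1 i).symm
  rw [secondDegree_eq_sum, Fin.sum_univ_castSucc]
  simp [-Finset.sum_boole, h1, h2]

/-- The edges counted are those at `s` other than the new one. The edge added with `s` is counted
separately unless it is a loop, which is already part of the in-degree. -/
theorem secondDegree_extend_last (f : EdgeMap n) (s : Fin n) :
    (f.extend s.castSucc).secondDegree (Fin.last n)
      = f.inDegree s + if f s = s then 0 else 1 := by
  have h1 : ∀ i : Fin n, i.castSucc ≠ Fin.last n := fun i => (Fin.castSucc_lt_last _).ne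
  have h2 : ∀ i : Fin n, Fin.last n ≠ i.castSucc := fun i => (h1 i).symm
  have h3 : ∀ i : Fin n, (if s = i ∨ s = f i then 1 else 0)
      = (if f i = s then 1 else 0) + if i = s then (if f s = s then 0 else 1) else 0 := by
    intro i
    by_cases h : i = s
    · subst h
      by_cases h' : f i = i <;> simp [h']
    · simp [h, Ne.symm h, eq_comm]
  rw [secondDegree_eq_sum, Fin.sum_univ_castSucc]
  simp [-Finset.sum_boole, h1, h2, inDegree, h3, Finset.sum_add_distrib]

/-! ### The weight of the neighbours as a function of the state -/

/-- The total attachment weight of the neighbours of `t`. -/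
noncomputable def neighborWeight (a : ℝ) (f : EdgeMap n) (t : Fin n) : ℝ :=
  ∑ s, if f.Adjacent t s then (f.inDegree s : ℝ) + a else 0

theorem adjacent_extend_castSucc (f : EdgeMap n) (s : Fin (n + 1)) (t u : Fin n) :
    (f.extend s).Adjacent t.castSucc u.castSucc ↔ f.Adjacent t u := by
  simp [Adjacent]

theorem adjacent_extend_castSucc_last (f : EdgeMap n) (s : Fin (n + 1)) (t : Fin n) :
    (f.extend s).Adjacent t.castSucc (Fin.last n) ↔ s = t.castSucc := by
  have h1 : ∀ i : Fin n, i.castSucc ≠ Fin.last n := fun i => (Fin.castSucc_lt_last _).ne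
  simp [Adjacent, h1, (h1 t).symm]

theorem adjacent_extend_last_castSucc (f : EdgeMap n) (s : Fin (n + 1)) (u : Fin n) :
    (f.extend s).Adjacent (Fin.last n) u.castSucc ↔ s = u.castSucc := by
  have h1 : ∀ i : Fin n, i.castSucc ≠ Fin.last n := fun i => (Fin.castSucc_lt_last _).ne
  simp [Adjacent, h1]

/-- The difference between the weight of the neighbours and the second degree, apart from the
contribution of the edges sent to the vertex. -/
noncomputable def weightExcess (a : ℝ) (f : EdgeMap n) (t : Fin n) : ℝ :=
  if f t = t then -a else if f (f t) = f t then a + 1 else a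

theorem weightExcess_extend_castSucc (a : ℝ) (f : EdgeMap n) (s : Fin (n + 1)) (t : Fin n) :
    weightExcess a (f.extend s) t.castSucc = weightExcess a f t := by
  simp [weightExcess]

/-- In a forest each edge counted by the second degree hangs on one neighbour. The edges sent to a
child are all counted. For a loopless parent, the edge from `t` enters its in-degree but not the
count, and its own edge the reverse, so the two cancel; for a parent with a loop there is an excess
of 1. Each neighbour also adds `a`, and for a loop at `t` the term `-a` removes the loop from the
in-degree. The proof checks that each step preserves the identity. -/
theorem Reachable.neighborWeight_eq (a : ℝ) {f : EdgeMap n} (h : Reachable n f) (t : Fin n) :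
    f.neighborWeight a t = f.secondDegree t + weightExcess a f t + a * f.inDegree t := by
  induction h with
  | empty f => exact t.elim0
  | @extend n f s _ ih =>
    induction t using Fin.lastCases with
    | last =>
      unfold neighborWeight
      rw [Fin.sum_univ_castSucc]
      simp only [adjacent_extend_last_castSucc, inDegree_extend_castSucc]
      have hself : ¬ (f.extend s).Adjacent (Fin.last n) (Fin.last n) := fun h => h.1 rfl
      rw [if_neg hself, add_zero]
      induction s using Fin.lastCases with
      | last =>
        have h1 : ∀ i : Fin n, Fin.last n ≠ i.castSucc := fun i => (Fin.castSucc_lt_last _).ne'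
        simp [h1, secondDegree_extend_last_self, weightExcess, inDegree_extend_last]
      | cast s =>
        have h1 : s.castSucc ≠ Fin.last n := (Fin.castSucc_lt_last _).ne
        simp only [Fin.castSucc_inj, Finset.sum_ite_eq, Finset.mem_univ, if_true,
          secondDegree_extend_last, inDegree_extend_last, h1, if_false, weightExcess,
          extend_last, extend_castSucc]
        by_cases hs : f s = s
        · simp [hs]
          ring
        · simp [hs]
    | cast t =>
      have ih := ih t
      unfold neighborWeight at ih ⊢
      rw [Fin.sum_univ_castSucc]
      simp only [adjacent_extend_castSucc, adjacent_extend_castSucc_last, inDegree_extend_castSucc,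
        weightExcess_extend_castSucc, inDegree_extend_last]
      induction s using Fin.lastCases with
      | last =>
        have h1 : ∀ i : Fin n, Fin.last n ≠ i.castSucc := fun i => (Fin.castSucc_lt_last _).ne'
        simp only [h1, if_false, secondDegree_extend_self, add_zero]
        exact ih
      | cast s =>
        have h1 : s.castSucc ≠ Fin.last n := (Fin.castSucc_lt_last _).ne
        simp only [Fin.castSucc_inj, secondDegree_extend_castSucc, h1, if_false]
        have e : ∀ u : Fin n, (if f.Adjacent t u then
            ((f.inDegree u + if s = u then 1 else 0 : ℕ) : ℝ) + a else 0)
            = (if f.Adjacent t u then (f.inDegree u : ℝ) + a else 0)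
              + if s = u then (if f.Adjacent t s then 1 else 0) else 0 := by
          intro u
          by_cases hu : s = u
          · subst hu
            by_cases hadj : f.Adjacent t s
            · simp [hadj]
              ring
            · simp [hadj]
          · simp [hu]
        simp only [e, Finset.sum_add_distrib, Finset.sum_ite_eq, Finset.mem_univ, if_true]
        rw [ih]
        push_cast
        split_ifs <;> ring

end EdgeMap

/-! ### Vertex kinds, room in the total weight, and one-step transitions -/

namespace EdgeMap

variable {n : ℕ}

/-- Vertices with a loop, vertices attached to a vertex with a loop, and all the others. -/
inductive VertexKind
  | loop
  | nearLoop
  | plain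

namespace VertexKind

/-- The number of edges sent to a vertex of this kind that do not come from another vertex. -/
def offset : VertexKind → ℕ
  | loop => 1
  | nearLoop => 0
  | plain => 0

/-- The attachment weight of a vertex of this kind without children. -/
noncomputable def ownBase (a : ℝ) : VertexKind → ℝ
  | loop => a + 1
  | nearLoop => a
  | plain => a

/-- The weight of the neighbours of a vertex of this kind without children, apart from the second
degree. -/
noncomputable def neighborBase (a : ℝ) : VertexKind → ℝ
  | loop => 0
  | nearLoop => a + 1
  | plain => a

theorem ownBase_eq (a : ℝ) (τ : VertexKind) : τ.ownBase a = a + τ.offset := by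
  cases τ <;> simp [ownBase, offset]

theorem ownBase_pos {a : ℝ} (ha : 0 < a) (τ : VertexKind) : 0 < τ.ownBase a := by
  rw [ownBase_eq]; positivity

theorem neighborBase_nonneg {a : ℝ} (ha : 0 < a) (τ : VertexKind) : 0 ≤ τ.neighborBase a := by
  cases τ <;> simp only [neighborBase] <;> positivity

end VertexKind

/-- The kind of the vertex `t`. -/
def kind (f : EdgeMap n) (t : Fin n) : VertexKind :=
  if f t = t then .loop else if f (f t) = f t then .nearLoop else .plain

theorem weightExcess_eq (a : ℝ) (f : EdgeMap n) (t : Fin n) :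
    weightExcess a f t = (f.kind t).neighborBase a - a * (f.kind t).offset := by
  unfold weightExcess kind
  split_ifs <;> simp [VertexKind.neighborBase, VertexKind.offset]

theorem kind_extend_castSucc (f : EdgeMap n) (s : Fin (n + 1)) (t : Fin n) :
    (f.extend s).kind t.castSucc = f.kind t := by
  simp [kind]

theorem kind_extend_last_self (f : EdgeMap n) :
    (f.extend (Fin.last n)).kind (Fin.last n) = .loop := by
  simp [kind]

theorem kind_extend_last (f : EdgeMap n) (s : Fin n) :
    (f.extend s.castSucc).kind (Fin.last n) = if f s = s then .nearLoop else .plain := by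
  have h : s.castSucc ≠ Fin.last n := (Fin.castSucc_lt_last _).ne
  simp [kind, h]

theorem offset_kind_le_inDegree (f : EdgeMap n) (t : Fin n) :
    (f.kind t).offset ≤ f.inDegree t := by
  unfold kind
  split_ifs with h1 h2
  · exact one_le_inDegree_of_loop h1
  · exact Nat.zero_le _
  · exact Nat.zero_le _

theorem sum_inDegree (f : EdgeMap n) : ∑ s, f.inDegree s = n := by
  unfold inDegree
  rw [Finset.sum_comm]
  simp

/-- Old vertices that are not neighbours of `t` leave some room between the weight of `t` together
with its neighbours and the total weight. -/
theorem Reachable.weight_le {a : ℝ} (ha : 0 < a) {M : ℕ} (hM : 1 + a ≤ ((M : ℝ) - 1) * a)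
    {f : EdgeMap n} (h : Reachable n f) {t : Fin n} (ht : M ≤ t) :
    f.inDegree t + a + f.neighborWeight a t + (1 + a) ≤ stepDenom a n := by
  -- The neighbours of `t` are its parent and later vertices. So each of the first `M` vertices,
  -- except possibly the parent, contributes at least `a` beyond the weight of `t` and its
  -- neighbours; this yields `(M - 1) * a` of room.
  have hpt : ∀ s : Fin n, (if s = t then (f.inDegree t : ℝ) + a else 0)
      + (if f.Adjacent t s then (f.inDegree s : ℝ) + a else 0)
      + (if (s : ℕ) < M then a else 0) - (if s = f t then a else 0) ≤ f.inDegree s + a := by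
    intro s
    have h0 : (0 : ℝ) ≤ f.inDegree s := Nat.cast_nonneg _
    by_cases hst : s = t
    · subst hst
      have hadj : ¬ f.Adjacent s s := fun h => h.1 rfl
      rw [if_pos rfl, if_neg hadj, if_neg (by omega)]
      split_ifs <;> linarith
    · rw [if_neg hst]
      by_cases hadj : f.Adjacent t s
      · rw [if_pos hadj]
        by_cases hs : s = f t
        · rw [if_pos hs]
          split_ifs <;> linarith
        · have h1 : f s = t := (hadj.2.resolve_left fun h => hs h.symm)
          have h2 := h.apply_le s
          rw [h1, Fin.le_def] at h2
          rw [if_neg hs, if_neg (by omega)]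
          linarith
      · rw [if_neg hadj]
        split_ifs <;> linarith
  have hsum := Finset.sum_le_sum fun s (_ : s ∈ Finset.univ) => hpt s
  rw [Finset.sum_sub_distrib, Finset.sum_add_distrib, Finset.sum_add_distrib,
    Finset.sum_add_distrib] at hsum
  have hc : ∑ s : Fin n, (if (s : ℕ) < M then a else 0) = M * a := by
    rw [Fin.sum_univ_eq_sum_range (fun i => if i < M then a else 0) n, ← Finset.sum_filter,
      Finset.sum_const, nsmul_eq_mul]
    congr 2
    have : (Finset.range n).filter (· < M) = Finset.range M := by
      ext i
      simp only [Finset.mem_filter, Finset.mem_range]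
      have := t.2
      omega
    rw [this, Finset.card_range]
  have hd : (∑ s : Fin n, (f.inDegree s : ℝ)) = n := by exact_mod_cast f.sum_inDegree
  rw [hc, hd] at hsum
  simp only [Finset.sum_ite_eq', Finset.mem_univ, if_true, Finset.sum_const, Finset.card_univ,
    Fintype.card_fin, nsmul_eq_mul] at hsum
  change _ + f.neighborWeight a t + _ - _ ≤ _ at hsum
  unfold stepDenom
  linarith

theorem stepProb_castSucc (a : ℝ) (f : EdgeMap n) (s : Fin n) :
    stepProb a f s.castSucc = (f.inDegree s + a) / stepDenom a n := by
  simp [stepProb, stepDenom, degree_eq]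

theorem stepProb_last (a : ℝ) (f : EdgeMap n) :
    stepProb a f (Fin.last n) = a / stepDenom a n := by
  simp [stepProb, stepDenom]

/-- The effect of one step on a function of the in-degree and second degree of an old vertex. -/
theorem sum_stepProb_mul_old {a : ℝ} (ha : 0 < a) (f : EdgeMap n) (t : Fin n) (X : ℕ → ℕ → ℝ) :
    ∑ s, stepProb a f s
        * X ((f.extend s).inDegree t.castSucc) ((f.extend s).secondDegree t.castSucc)
      = (1 - (f.inDegree t + a + f.neighborWeight a t) / stepDenom a n)
          * X (f.inDegree t) (f.secondDegree t)
        + (f.inDegree t + a) / stepDenom a n * X (f.inDegree t + 1) (f.secondDegree t)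
        + f.neighborWeight a t / stepDenom a n * X (f.inDegree t) (f.secondDegree t + 1) := by
  have h1 := sum_stepProb ha f
  rw [Fin.sum_univ_castSucc] at h1 ⊢
  have hl : Fin.last n ≠ t.castSucc := (Fin.castSucc_lt_last _).ne'
  set x := X (f.inDegree t) (f.secondDegree t)
  have e : ∀ s : Fin n, stepProb a f s.castSucc * X ((f.extend s.castSucc).inDegree t.castSucc)
      ((f.extend s.castSucc).secondDegree t.castSucc)
      = stepProb a f s.castSucc * x
        + (if s = t then (f.inDegree t + a) / stepDenom a n
            * (X (f.inDegree t + 1) (f.secondDegree t) - x) else 0)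
        + (if f.Adjacent t s then (f.inDegree s : ℝ) + a else 0)
          * ((X (f.inDegree t) (f.secondDegree t + 1) - x) / stepDenom a n) := by
    intro s
    rw [inDegree_extend_castSucc, secondDegree_extend_castSucc]
    simp only [Fin.castSucc_inj]
    by_cases hst : s = t
    · subst hst
      have hadj : ¬ f.Adjacent s s := fun h => h.1 rfl
      simp only [if_true, if_neg hadj, add_zero, stepProb_castSucc]
      ring
    · by_cases hadj : f.Adjacent t s
      · simp only [if_neg hst, if_pos hadj, add_zero, stepProb_castSucc]
        ring
      · simp only [if_neg hst, if_neg hadj, add_zero, zero_mul]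
        rfl
  rw [Finset.sum_congr rfl fun s _ => e s, Finset.sum_add_distrib, Finset.sum_add_distrib,
    ← Finset.sum_mul, ← Finset.sum_mul, Finset.sum_ite_eq', if_pos (Finset.mem_univ _),
    inDegree_extend_castSucc, if_neg hl, add_zero, secondDegree_extend_self]
  change _ + f.neighborWeight a t * _ + _ * x = _
  -- The probability of no change comes from the probabilities summing to one.
  linear_combination x * h1

open Classical in
/-- The number of vertices from the `M`-th on with given kind, number of children and second
degree. -/
noncomputable def profileCount (M : ℕ) (τ : VertexKind) (l k : ℕ) (f : EdgeMap n) : ℝ :=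
  ∑ t : Fin n, if M ≤ (t : ℕ) ∧ f.kind t = τ ∧ f.inDegree t = l + τ.offset ∧ f.secondDegree t = k
    then 1 else 0

/-- The number of vertices without a loop and with in-degree `j`. -/
noncomputable def treeCount (j : ℕ) (f : EdgeMap n) : ℝ :=
  ∑ t : Fin n, if f t ≠ t ∧ f.inDegree t = j then 1 else 0

/-- The number of vertices with a loop and with `j` other edges sent to them. -/
noncomputable def loopCount (j : ℕ) (f : EdgeMap n) : ℝ :=
  ∑ t : Fin n, if f t = t ∧ f.inDegree t = j + 1 then 1 else 0

theorem profileCount_nonneg (M : ℕ) (τ : VertexKind) (l k : ℕ) (f : EdgeMap n) :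
    0 ≤ profileCount M τ l k f :=
  Finset.sum_nonneg fun t _ => by split_ifs <;> simp

theorem treeCount_nonneg (j : ℕ) (f : EdgeMap n) : 0 ≤ treeCount j f :=
  Finset.sum_nonneg fun t _ => by split_ifs <;> simp

theorem loopCount_nonneg (j : ℕ) (f : EdgeMap n) : 0 ≤ loopCount j f :=
  Finset.sum_nonneg fun t _ => by split_ifs <;> simp

theorem profileCount_eq_zero_of_le {M : ℕ} (h : n ≤ M) (τ : VertexKind) (l k : ℕ)
    (f : EdgeMap n) : profileCount M τ l k f = 0 :=
  Finset.sum_eq_zero fun t _ => if_neg fun h' => by have := t.2; omega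

theorem treeCount_eq_zero {j : ℕ} (h : n < j) (f : EdgeMap n) : treeCount j f = 0 :=
  Finset.sum_eq_zero fun t _ => if_neg fun h' => by have := f.inDegree_le t; omega

theorem loopCount_eq_zero {j : ℕ} (h : n < j + 1) (f : EdgeMap n) : loopCount j f = 0 :=
  Finset.sum_eq_zero fun t _ => if_neg fun h' => by have := f.inDegree_le t; omega

theorem treeCount_le (j : ℕ) (f : EdgeMap n) : treeCount j f ≤ n := by
  unfold treeCount
  calc _ ≤ ∑ _t : Fin n, (1 : ℝ) := Finset.sum_le_sum fun t _ => by split_ifs <;> simp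
    _ = n := by simp

theorem loopCount_le (j : ℕ) (f : EdgeMap n) : loopCount j f ≤ n := by
  unfold loopCount
  calc _ ≤ ∑ _t : Fin n, (1 : ℝ) := Finset.sum_le_sum fun t _ => by split_ifs <;> simp
    _ = n := by simp

theorem Reachable.weight_of_state {a : ℝ} {f : EdgeMap n} (h : Reachable n f) {t : Fin n}
    {τ : VertexKind} {l k : ℕ} (h1 : f.kind t = τ) (h2 : f.inDegree t = l + τ.offset)
    (h3 : f.secondDegree t = k) :
    (f.inDegree t : ℝ) + a = l + τ.ownBase a ∧
      f.neighborWeight a t = k + τ.neighborBase a + a * l := by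
  constructor
  · rw [h2, VertexKind.ownBase_eq]
    push_cast
    ring
  · rw [h.neighborWeight_eq, weightExcess_eq, h1, h2, h3]
    push_cast
    ring

/-- The room `1 + a` is the largest change of total weight in one step: raising `l` adds `1 + a`,
raising `k` adds 1. Hence the predecessors of an overweight state are empty too. -/
theorem Reachable.profileCount_eq_zero {a : ℝ} (ha : 0 < a) {M : ℕ}
    (hM : 1 + a ≤ ((M : ℝ) - 1) * a) {f : EdgeMap n} (h : Reachable n f) {τ : VertexKind}
    {l k : ℕ} (hw : stepDenom a n < l + τ.ownBase a + (k + τ.neighborBase a + a * l) + (1 + a)) :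
    profileCount M τ l k f = 0 := by
  refine Finset.sum_eq_zero fun t _ => if_neg ?_
  rintro ⟨h0, h1, h2, h3⟩
  obtain ⟨e1, e2⟩ := h.weight_of_state (a := a) h1 h2 h3
  have := h.weight_le ha hM h0
  rw [e1, e2] at this
  linarith

/-- The contribution of a new vertex to the profile, up to the normalizing factor. -/
noncomputable def profileBirth (a : ℝ) (τ : VertexKind) (k : ℕ) (f : EdgeMap n) : ℝ :=
  match τ with
  | .loop => if k = 0 then a else 0
  | .nearLoop => if k = 0 then 0 else (k + a) * loopCount (k - 1) f
  | .plain => if k = 0 then 0 else (k - 1 + a) * treeCount (k - 1) f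

-- Linearity over vertices: each old vertex moves with rates determined by its state, so the counts
-- satisfy a closed recursion.
open Classical in
theorem Reachable.sum_stepProb_mul_profileCount_old {a : ℝ} (ha : 0 < a) (M : ℕ) {f : EdgeMap n}
    (h : Reachable n f) (τ : VertexKind) (l k : ℕ) :
    ∑ s, stepProb a f s * ∑ t : Fin n, (if M ≤ (t : ℕ) ∧ (f.extend s).kind t.castSucc = τ ∧
        (f.extend s).inDegree t.castSucc = l + τ.offset ∧
        (f.extend s).secondDegree t.castSucc = k then (1 : ℝ) else 0)
      = (1 - (l + τ.ownBase a + (k + τ.neighborBase a + a * l)) / stepDenom a n)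
          * profileCount M τ l k f
        + (if l = 0 then 0 else (l - 1 + τ.ownBase a) * profileCount M τ (l - 1) k f)
          / stepDenom a n
        + (if k = 0 then 0 else (k - 1 + τ.neighborBase a + a * l) * profileCount M τ l (k - 1) f)
          / stepDenom a n := by
  set I : ℕ → ℕ → Fin n → ℝ := fun l k t => if M ≤ (t : ℕ) ∧ f.kind t = τ ∧
    f.inDegree t = l + τ.offset ∧ f.secondDegree t = k then 1 else 0 with hI
  have hpc : ∀ l k, profileCount M τ l k f = ∑ t, I l k t := fun l k => rfl
  have hterm : ∀ t : Fin n, ∑ s, stepProb a f s * (if M ≤ (t : ℕ) ∧ (f.extend s).kind t.castSucc = τ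
      ∧ (f.extend s).inDegree t.castSucc = l + τ.offset ∧
        (f.extend s).secondDegree t.castSucc = k then (1 : ℝ) else 0)
      = (1 - (l + τ.ownBase a + (k + τ.neighborBase a + a * l)) / stepDenom a n) * I l k t
        + (if l = 0 then 0 else (l - 1 + τ.ownBase a) * I (l - 1) k t) / stepDenom a n
        + (if k = 0 then 0 else (k - 1 + τ.neighborBase a + a * l) * I l (k - 1) t)
          / stepDenom a n := by
    intro t
    have key := sum_stepProb_mul_old ha f t (fun i j => if M ≤ (t : ℕ) ∧ f.kind t = τ ∧
      i = l + τ.offset ∧ j = k then 1 else 0)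
    simp only [kind_extend_castSucc]
    rw [key]
    congr 1
    · congr 1
      · by_cases hx : M ≤ (t : ℕ) ∧ f.kind t = τ ∧ f.inDegree t = l + τ.offset ∧
          f.secondDegree t = k
        · obtain ⟨e1, e2⟩ := h.weight_of_state (a := a) hx.2.1 hx.2.2.1 hx.2.2.2
          simp only [hI, if_pos hx, e1, e2]
        · simp only [hI, if_neg hx, mul_zero]
      · by_cases hx : M ≤ (t : ℕ) ∧ f.kind t = τ ∧ f.inDegree t + 1 = l + τ.offset ∧
          f.secondDegree t = k
        · have hoff := offset_kind_le_inDegree f t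
          rw [hx.2.1] at hoff
          have hl : l ≠ 0 := by
            have := hx.2.2.1
            omega
          have hd : f.inDegree t = (l - 1) + τ.offset := by
            have := hx.2.2.1
            omega
          obtain ⟨e1, -⟩ := h.weight_of_state (a := a) hx.2.1 hd hx.2.2.2
          rw [Nat.cast_sub (by omega), Nat.cast_one] at e1
          simp only [hI]
          rw [if_pos hx, if_neg hl, if_pos ⟨hx.1, hx.2.1, hd, hx.2.2.2⟩, e1]
          ring
        · rw [if_neg hx, mul_zero]
          split_ifs with hl
          · simp
          · simp only [hI]
            rw [if_neg, mul_zero, zero_div]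
            rintro ⟨h1, h2, h3, h4⟩
            exact hx ⟨h1, h2, by omega, h4⟩
    · by_cases hx : M ≤ (t : ℕ) ∧ f.kind t = τ ∧ f.inDegree t = l + τ.offset ∧
          f.secondDegree t + 1 = k
      · have hk : k ≠ 0 := by
          have := hx.2.2.2
          omega
        have hd : f.secondDegree t = k - 1 := by
          have := hx.2.2.2
          omega
        obtain ⟨-, e2⟩ := h.weight_of_state (a := a) hx.2.1 hx.2.2.1 hd
        rw [Nat.cast_sub (by omega), Nat.cast_one] at e2
        simp only [hI]
        rw [if_pos hx, if_neg hk, if_pos ⟨hx.1, hx.2.1, hx.2.2.1, hd⟩, e2]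
        ring
      · rw [if_neg hx, mul_zero]
        split_ifs with hk
        · simp
        · simp only [hI]
          rw [if_neg, mul_zero, zero_div]
          rintro ⟨h1, h2, h3, h4⟩
          exact hx ⟨h1, h2, h3, by omega⟩
  simp only [Finset.mul_sum]
  rw [Finset.sum_comm, Finset.sum_congr rfl fun t _ => hterm t, Finset.sum_add_distrib,
    Finset.sum_add_distrib, ← Finset.mul_sum, ← Finset.sum_div, ← Finset.sum_div]
  simp only [hpc]
  congr 1
  · congr 1
    split_ifs
    · simp
    · rw [Finset.mul_sum]
  · split_ifs
    · simp
    · rw [Finset.mul_sum]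

open Classical in
theorem sum_stepProb_mul_profileCount_new (a : ℝ) (f : EdgeMap n) (τ : VertexKind) (l k : ℕ) :
    ∑ s, stepProb a f s * (if (f.extend s).kind (Fin.last n) = τ ∧
        (f.extend s).inDegree (Fin.last n) = l + τ.offset ∧
        (f.extend s).secondDegree (Fin.last n) = k then (1 : ℝ) else 0)
      = (if l = 0 then profileBirth a τ k f else 0) / stepDenom a n := by
  have hne : ∀ s : Fin n, s.castSucc ≠ Fin.last n := fun s => (Fin.castSucc_lt_last _).ne
  rw [Fin.sum_univ_castSucc]
  simp only [stepProb_castSucc, stepProb_last, kind_extend_last, kind_extend_last_self,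
    inDegree_extend_last, if_neg (hne _), if_true, secondDegree_extend_last,
    secondDegree_extend_last_self]
  cases τ with
  | loop =>
    have h0 : ∀ s : Fin n, (if f s = s then VertexKind.nearLoop else VertexKind.plain) ≠ .loop := by
      intro s
      split_ifs <;> simp
    simp only [h0, false_and, if_false, mul_zero, Finset.sum_const_zero, zero_add,
      VertexKind.offset, profileBirth, true_and]
    by_cases hl : l = 0
    · by_cases hk : k = 0
      · simp [hl, hk]
      · simp [hl, hk, Ne.symm hk]
    · simp [hl]
  | nearLoop =>
    simp only [VertexKind.offset, profileBirth, reduceCtorEq, false_and, if_false, mul_zero,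
      add_zero]
    by_cases hl : l = 0
    · subst hl
      rw [if_pos rfl]
      by_cases hk : k = 0
      · rw [if_pos hk, zero_div]
        refine Finset.sum_eq_zero fun s _ => ?_
        rw [if_neg, mul_zero]
        rintro ⟨h1, -, h3⟩
        by_cases hs : f s = s
        · have := one_le_inDegree_of_loop hs
          omega
        · simp [hs] at h1
      · rw [if_neg hk, loopCount, Finset.mul_sum, Finset.sum_div]
        refine Finset.sum_congr rfl fun s _ => ?_
        have hk1 : k - 1 + 1 = k := by omega
        by_cases hs : f s = s
        · by_cases hd : f.inDegree s = k
          · simp [hs, hd, hk1]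
          · simp [hs, hd, hk1]
        · simp [hs]
    · simp [hl, Ne.symm hl]
  | plain =>
    simp only [VertexKind.offset, profileBirth, reduceCtorEq, false_and, if_false, mul_zero,
      add_zero]
    by_cases hl : l = 0
    · subst hl
      rw [if_pos rfl]
      by_cases hk : k = 0
      · rw [if_pos hk, zero_div]
        refine Finset.sum_eq_zero fun s _ => ?_
        rw [if_neg, mul_zero]
        rintro ⟨h1, -, h3⟩
        by_cases hs : f s = s
        · simp [hs] at h1
        · simp [hs, hk] at h3
      · rw [if_neg hk, treeCount, Finset.mul_sum, Finset.sum_div]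
        refine Finset.sum_congr rfl fun s _ => ?_
        by_cases hs : f s = s
        · simp [hs]
        · by_cases hd : f.inDegree s = k - 1
          · have : k - 1 + 1 = k := by omega
            simp [hs, hd, this]
            rw [Nat.cast_sub (by omega), Nat.cast_one]
          · have : f.inDegree s + 1 ≠ k := by omega
            simp [hs, hd, this]
    · simp [hl, Ne.symm hl]

end EdgeMap

/-! ### Expectation as a linear functional, and recursions for expected counts -/

open EdgeMap

/-- The expected value of a function of the next graph, given the present one. -/
noncomputable def stepExpect (a : ℝ) (n : ℕ) : (EdgeMap (n + 1) → ℝ) →ₗ[ℝ] (EdgeMap n → ℝ) where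
  toFun g f := ∑ s, stepProb a f s * g (f.extend s)
  map_add' g h := by
    funext f
    simp [mul_add, Finset.sum_add_distrib]
  map_smul' c g := by
    funext f
    simp only [Pi.smul_apply, smul_eq_mul, RingHom.id_apply, Finset.mul_sum]
    exact Finset.sum_congr rfl fun s _ => by ring

theorem stepExpect_apply (a : ℝ) {n : ℕ} (g : EdgeMap (n + 1) → ℝ) (f : EdgeMap n) :
    stepExpect a n g f = ∑ s, stepProb a f s * g (f.extend s) := rfl

/-- The expected value of a function of the graph on `n` vertices. -/
noncomputable def graphExpect (a : ℝ) : (n : ℕ) → (EdgeMap n → ℝ) →ₗ[ℝ] ℝ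
  | 0 => LinearMap.proj Fin.elim0
  | n + 1 => (graphExpect a n).comp (stepExpect a n)

theorem graphExpect_succ (a : ℝ) (n : ℕ) (g : EdgeMap (n + 1) → ℝ) :
    graphExpect a (n + 1) g = graphExpect a n (stepExpect a n g) := rfl

/-- Comparison is needed only on reachable graphs, which gives access to the forest structure. -/
theorem graphExpect_mono {a : ℝ} (ha : 0 < a) {n : ℕ} {g h : EdgeMap n → ℝ}
    (H : ∀ f, Reachable n f → g f ≤ h f) : graphExpect a n g ≤ graphExpect a n h := by
  induction n with
  | zero => exact H _ (Reachable.empty _)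
  | succ n ih =>
    refine ih fun f hf => ?_
    rw [stepExpect_apply, stepExpect_apply]
    refine Finset.sum_le_sum fun s _ => ?_
    exact mul_le_mul_of_nonneg_left (H _ (hf.extend s)) (stepProb_nonneg ha f s)

theorem graphExpect_congr {a : ℝ} (ha : 0 < a) {n : ℕ} {g h : EdgeMap n → ℝ}
    (H : ∀ f, Reachable n f → g f = h f) : graphExpect a n g = graphExpect a n h :=
  le_antisymm (graphExpect_mono ha fun f hf => (H f hf).le)
    (graphExpect_mono ha fun f hf => (H f hf).ge)

theorem graphExpect_const {a : ℝ} (ha : 0 < a) (n : ℕ) (c : ℝ) :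
    graphExpect a n (fun _ => c) = c := by
  induction n with
  | zero => rfl
  | succ n ih =>
    rw [graphExpect_succ, show stepExpect a n (fun _ => c) = fun _ => c from ?_, ih]
    funext f
    rw [stepExpect_apply, ← Finset.sum_mul, sum_stepProb ha, one_mul]

theorem graphExpect_const_mul (a : ℝ) {n : ℕ} (c : ℝ) (g : EdgeMap n → ℝ) :
    graphExpect a n (fun f => c * g f) = c * graphExpect a n g :=
  (graphExpect a n).map_smul c g

theorem graphExpect_add (a : ℝ) {n : ℕ} (g h : EdgeMap n → ℝ) :
    graphExpect a n (fun f => g f + h f) = graphExpect a n g + graphExpect a n h :=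
  (graphExpect a n).map_add g h

theorem graphExpect_sum (a : ℝ) {n : ℕ} {ι : Type*} (s : Finset ι) (g : ι → EdgeMap n → ℝ) :
    graphExpect a n (fun f => ∑ i ∈ s, g i f) = ∑ i ∈ s, graphExpect a n (g i) := by
  rw [← map_sum]
  congr 1
  funext f
  simp

theorem graphExpect_zero {a : ℝ} (ha : 0 < a) {n : ℕ} {g : EdgeMap n → ℝ}
    (H : ∀ f, Reachable n f → g f = 0) : graphExpect a n g = 0 := by
  rw [graphExpect_congr ha H, graphExpect_const ha]

theorem graphExpect_nonneg {a : ℝ} (ha : 0 < a) {n : ℕ} {g : EdgeMap n → ℝ}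
    (H : ∀ f, 0 ≤ g f) : 0 ≤ graphExpect a n g := by
  rw [← graphExpect_const ha n 0]
  exact graphExpect_mono ha fun f _ => H f

/-- Connects the functional with the law in the statement, by conditioning on the graph one step
earlier. -/
theorem integral_law_eq {a : ℝ} (ha : 0 < a) (n : ℕ) (g : EdgeMap n → ℝ) :
    ∫ f, g f ∂(law ha n).toMeasure = graphExpect a n g := by
  rw [PMF.integral_eq_sum]
  induction n with
  | zero =>
    rw [Fintype.sum_eq_single (Fin.elim0 : EdgeMap 0) fun f hf => absurd (Subsingleton.elim _ _) hf]
    simp [law, graphExpect]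
  | succ n ih =>
    rw [graphExpect_succ, ← ih]
    have h1 : ∀ f' : EdgeMap (n + 1), ((law ha (n + 1)) f').toReal
        = ∑ f : EdgeMap n, ∑ s : Fin (n + 1),
          ((law ha n) f).toReal * (stepProb a f s * if f' = f.extend s then 1 else 0) := by
      intro f'
      rw [law, PMF.bind_apply, tsum_fintype, ENNReal.toReal_sum]
      · refine Finset.sum_congr rfl fun f _ => ?_
        rw [ENNReal.toReal_mul, ← Finset.mul_sum]
        congr 1
        rw [PMF.map_apply, tsum_fintype, ENNReal.toReal_sum]
        · refine Finset.sum_congr rfl fun s _ => ?_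
          split_ifs
          · rw [step, PMF.ofFintype_apply, ENNReal.toReal_ofReal (stepProb_nonneg ha f s), mul_one]
          · simp
        · intro s _
          split_ifs
          · exact PMF.apply_ne_top _ _
          · simp
      · intro f _
        exact ENNReal.mul_ne_top (PMF.apply_ne_top _ _) (PMF.apply_ne_top _ _)
    simp only [h1, smul_eq_mul, stepExpect_apply, Finset.sum_mul, Finset.mul_sum]
    rw [Finset.sum_comm]
    refine Finset.sum_congr rfl fun f _ => ?_
    rw [Finset.sum_comm]
    refine Finset.sum_congr rfl fun s _ => ?_
    rw [Fintype.sum_eq_single (f.extend s) fun f' hf' => by simp [hf']]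
    simp
    ring

theorem stepExpect_treeCount {a : ℝ} (ha : 0 < a) {n : ℕ} (j : ℕ) (f : EdgeMap n) :
    stepExpect a n (treeCount j) f
      = (1 - (j + a) / stepDenom a n) * treeCount j f
        + (if j = 0 then stepDenom a n - a else (j - 1 + a) * treeCount (j - 1) f)
          / stepDenom a n := by
  have hD := (stepDenom_pos ha n).ne'
  have hold : ∀ t : Fin n, ∑ s, stepProb a f s * (if (f.extend s) t.castSucc ≠ t.castSucc ∧
      (f.extend s).inDegree t.castSucc = j then (1 : ℝ) else 0)
      = (1 - (j + a) / stepDenom a n) * (if f t ≠ t ∧ f.inDegree t = j then 1 else 0)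
        + (if j = 0 then 0 else (j - 1 + a) * (if f t ≠ t ∧ f.inDegree t = j - 1 then 1 else 0))
          / stepDenom a n := by
    intro t
    have key := sum_stepProb_mul_old ha f t (fun i _ => if f t ≠ t ∧ i = j then 1 else 0)
    simp only [extend_castSucc, ne_eq, Fin.castSucc_inj]
    rw [key]
    by_cases ht : f t = t
    · simp [ht]
    · by_cases h1 : f.inDegree t = j
      · have : j ≠ j - 1 ∨ j = 0 := by omega
        rcases this with h | h
        · simp [ht, h1, h]
          field_simp
          ring
        · simp [ht, h1, h]
          field_simp
          ring
      · by_cases h2 : f.inDegree t + 1 = j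
        · have h3 : j ≠ 0 := by omega
          have h4 : f.inDegree t = j - 1 := by omega
          have h5 : (f.inDegree t : ℝ) = j - 1 := by
            rw [h4, Nat.cast_sub (by omega), Nat.cast_one]
          simp only [h1, h2, and_false, if_false, mul_zero, zero_add, add_zero]
          simp only [if_neg h3, h4, and_true, ne_eq, ht, not_false_eq_true, if_true]
          rw [← h4, h5]
          ring
        · have h4 : f.inDegree t = j - 1 → j = 0 := by omega
          simp only [h1, h2, and_false, if_false, mul_zero, zero_add]
          split_ifs with h5 h6
          · simp
          · exact absurd (h4 h6.2) h5
          · simp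
  have hnew : ∑ s, stepProb a f s * (if (f.extend s) (Fin.last n) ≠ Fin.last n ∧
      (f.extend s).inDegree (Fin.last n) = j then (1 : ℝ) else 0)
      = (if j = 0 then stepDenom a n - a else 0) / stepDenom a n := by
    have h1 := sum_stepProb ha f
    have hne : ∀ s : Fin n, s.castSucc ≠ Fin.last n := fun s => (Fin.castSucc_lt_last _).ne
    rw [Fin.sum_univ_castSucc, stepProb_last] at h1
    rw [Fin.sum_univ_castSucc]
    simp only [extend_last, inDegree_extend_last, hne, ne_eq, not_false_eq_true, true_and, if_false,
      not_true_eq_false, false_and, mul_zero, add_zero]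
    by_cases hj : j = 0
    · simp only [hj, if_true, mul_one, sub_div, div_self hD]
      linarith
    · simp [hj, Ne.symm hj]
  rw [stepExpect_apply]
  have e : ∀ s, treeCount j (f.extend s)
      = (∑ t : Fin n, if (f.extend s) t.castSucc ≠ t.castSucc ∧
          (f.extend s).inDegree t.castSucc = j then (1 : ℝ) else 0)
        + if (f.extend s) (Fin.last n) ≠ Fin.last n ∧
          (f.extend s).inDegree (Fin.last n) = j then (1 : ℝ) else 0 := fun s => by
    rw [treeCount, Fin.sum_univ_castSucc]
  simp only [e, mul_add, Finset.sum_add_distrib]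
  rw [hnew]
  simp only [treeCount, Finset.mul_sum]
  rw [Finset.sum_comm, Finset.sum_congr rfl fun t _ => hold t, Finset.sum_add_distrib,
    ← Finset.mul_sum, ← Finset.sum_div]
  by_cases hj : j = 0
  · simp [hj]
  · simp only [hj, if_false, zero_div, add_zero, Finset.mul_sum]

theorem stepExpect_loopCount {a : ℝ} (ha : 0 < a) {n : ℕ} (j : ℕ) (f : EdgeMap n) :
    stepExpect a n (loopCount j) f
      = (1 - (j + (a + 1)) / stepDenom a n) * loopCount j f
        + (if j = 0 then a else (j - 1 + (a + 1)) * loopCount (j - 1) f) / stepDenom a n := by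
  have hD := (stepDenom_pos ha n).ne'
  have hold : ∀ t : Fin n, ∑ s, stepProb a f s * (if (f.extend s) t.castSucc = t.castSucc ∧
      (f.extend s).inDegree t.castSucc = j + 1 then (1 : ℝ) else 0)
      = (1 - (j + (a + 1)) / stepDenom a n) * (if f t = t ∧ f.inDegree t = j + 1 then 1 else 0)
        + (if j = 0 then 0 else (j - 1 + (a + 1))
          * (if f t = t ∧ f.inDegree t = j - 1 + 1 then 1 else 0)) / stepDenom a n := by
    intro t
    have key := sum_stepProb_mul_old ha f t (fun i _ => if f t = t ∧ i = j + 1 then 1 else 0)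
    simp only [extend_castSucc, Fin.castSucc_inj]
    rw [key]
    by_cases ht : f t = t
    · have hpos := one_le_inDegree_of_loop ht
      by_cases h1 : f.inDegree t = j + 1
      · have : j + 1 ≠ j - 1 + 1 ∨ j = 0 := by omega
        rcases this with h | h
        · simp only [ht, h1, true_and, if_true, if_neg h, mul_zero, ite_self, zero_div,
            Nat.succ_ne_self]
          push_cast
          simp
          field_simp
          ring
        · simp [ht, h1, h]
          field_simp
          ring
      · by_cases h2 : f.inDegree t = j
        · have h3 : j ≠ 0 := by omega
          have h4 : f.inDegree t = j - 1 + 1 := by omega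
          have h5 : (f.inDegree t : ℝ) = j := by rw [h2]
          simp only [h1, and_false, if_false, mul_zero, zero_add, add_zero]
          rw [if_pos ⟨ht, by omega⟩, if_neg h3, if_pos ⟨ht, h4⟩, h5]
          ring
        · have h4 : f.inDegree t = j - 1 + 1 → j = 0 := by omega
          have h5 : ¬ (f.inDegree t + 1 = j + 1) := by omega
          simp only [h1, h5, and_false, if_false, mul_zero, zero_add]
          split_ifs with h5 h6
          · simp
          · exact absurd (h4 h6.2) h5
          · simp
    · simp [ht]
  have hnew : ∑ s, stepProb a f s * (if (f.extend s) (Fin.last n) = Fin.last n ∧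
      (f.extend s).inDegree (Fin.last n) = j + 1 then (1 : ℝ) else 0)
      = (if j = 0 then a else 0) / stepDenom a n := by
    have hne : ∀ s : Fin n, s.castSucc ≠ Fin.last n := fun s => (Fin.castSucc_lt_last _).ne
    rw [Fin.sum_univ_castSucc]
    simp only [extend_last, inDegree_extend_last, hne, true_and, if_true,
      false_and, if_false, mul_zero, Finset.sum_const_zero, zero_add, stepProb_last]
    by_cases hj : j = 0
    · simp [hj]
    · simp [hj]
  rw [stepExpect_apply]
  have e : ∀ s, loopCount j (f.extend s)
      = (∑ t : Fin n, if (f.extend s) t.castSucc = t.castSucc ∧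
          (f.extend s).inDegree t.castSucc = j + 1 then (1 : ℝ) else 0)
        + if (f.extend s) (Fin.last n) = Fin.last n ∧
          (f.extend s).inDegree (Fin.last n) = j + 1 then (1 : ℝ) else 0 := fun s => by
    rw [loopCount, Fin.sum_univ_castSucc]
  simp only [e, mul_add, Finset.sum_add_distrib]
  rw [hnew]
  simp only [loopCount, Finset.mul_sum]
  rw [Finset.sum_comm, Finset.sum_congr rfl fun t _ => hold t, Finset.sum_add_distrib,
    ← Finset.mul_sum, ← Finset.sum_div]
  by_cases hj : j = 0
  · simp [hj]
  · simp only [hj, if_false, zero_div, add_zero, Finset.mul_sum]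

theorem stepExpect_profileCount {a : ℝ} (ha : 0 < a) {M n : ℕ} (hn : M ≤ n) (τ : VertexKind)
    (l k : ℕ) {f : EdgeMap n} (h : Reachable n f) :
    stepExpect a n (profileCount M τ l k) f
      = (1 - (l + τ.ownBase a + (k + τ.neighborBase a + a * l)) / stepDenom a n)
          * profileCount M τ l k f
        + (if l = 0 then profileBirth a τ k f
            else (l - 1 + τ.ownBase a) * profileCount M τ (l - 1) k f) / stepDenom a n
        + (if k = 0 then 0 else (k - 1 + τ.neighborBase a + a * l) * profileCount M τ l (k - 1) f)
          / stepDenom a n := by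
  classical
  have h1 := h.sum_stepProb_mul_profileCount_old ha M τ l k
  have h2 := sum_stepProb_mul_profileCount_new a f τ l k
  have e : ∀ s, profileCount M τ l k (f.extend s)
      = (∑ t : Fin n, if M ≤ (t : ℕ) ∧ (f.extend s).kind t.castSucc = τ ∧
        (f.extend s).inDegree t.castSucc = l + τ.offset ∧
        (f.extend s).secondDegree t.castSucc = k then (1 : ℝ) else 0)
        + if (f.extend s).kind (Fin.last n) = τ ∧
        (f.extend s).inDegree (Fin.last n) = l + τ.offset ∧
        (f.extend s).secondDegree (Fin.last n) = k then (1 : ℝ) else 0 := by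
    intro s
    simp [-Finset.sum_boole, profileCount, Fin.sum_univ_castSucc (n := n), hn]
  rw [stepExpect_apply]
  simp only [e, mul_add, Finset.sum_add_distrib]
  rw [h1, h2]
  by_cases hl : l = 0
  · simp only [hl, if_true]
    ring
  · simp only [hl, if_false]
    ring

theorem mul_natCast_ge {a : ℝ} (ha : 0 < a) {M n : ℕ} (hM : 1 + a ≤ ((M : ℝ) - 1) * a)
    (hn : M ≤ n) : 1 + 2 * a ≤ a * n := by
  have : (M : ℝ) ≤ n := by exact_mod_cast hn
  nlinarith

theorem stepDenom_eq (a : ℝ) (n : ℕ) : stepDenom a n = (a + 1) * n + a := by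
  unfold stepDenom; ring

theorem graphExpect_treeCount_succ {a : ℝ} (ha : 0 < a) (n j : ℕ) :
    graphExpect a (n + 1) (treeCount j)
      = (1 - (j + a) / stepDenom a n) * graphExpect a n (treeCount j)
        + (if j = 0 then stepDenom a n - a else (j - 1 + a) * graphExpect a n (treeCount (j - 1)))
          / stepDenom a n := by
  rw [graphExpect_succ, graphExpect_congr ha fun f _ => stepExpect_treeCount ha j f,
    graphExpect_add, graphExpect_const_mul]
  congr 1
  split_ifs
  · rw [graphExpect_const ha]
  · simp only [div_eq_mul_inv, mul_comm _ (stepDenom a n)⁻¹, graphExpect_const_mul]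

theorem graphExpect_loopCount_succ {a : ℝ} (ha : 0 < a) (n j : ℕ) :
    graphExpect a (n + 1) (loopCount j)
      = (1 - (j + (a + 1)) / stepDenom a n) * graphExpect a n (loopCount j)
        + (if j = 0 then a else (j - 1 + (a + 1)) * graphExpect a n (loopCount (j - 1)))
          / stepDenom a n := by
  rw [graphExpect_succ, graphExpect_congr ha fun f _ => stepExpect_loopCount ha j f,
    graphExpect_add, graphExpect_const_mul]
  congr 1
  split_ifs
  · rw [graphExpect_const ha]
  · simp only [div_eq_mul_inv, mul_comm _ (stepDenom a n)⁻¹, graphExpect_const_mul]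

theorem graphExpect_profileCount_succ {a : ℝ} (ha : 0 < a) {M n : ℕ} (hn : M ≤ n)
    (τ : VertexKind) (l k : ℕ) :
    graphExpect a (n + 1) (profileCount M τ l k)
      = (1 - (l + τ.ownBase a + (k + τ.neighborBase a + a * l)) / stepDenom a n)
          * graphExpect a n (profileCount M τ l k)
        + (if l = 0 then graphExpect a n (profileBirth a τ k)
            else (l - 1 + τ.ownBase a) * graphExpect a n (profileCount M τ (l - 1) k))
          / stepDenom a n
        + (if k = 0 then 0 else (k - 1 + τ.neighborBase a + a * l)
            * graphExpect a n (profileCount M τ l (k - 1))) / stepDenom a n := by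
  rw [graphExpect_succ, graphExpect_congr ha fun f hf => stepExpect_profileCount ha hn τ l k hf,
    graphExpect_add, graphExpect_add, graphExpect_const_mul]
  congr 1
  · congr 1
    split_ifs
    · simp only [div_eq_mul_inv, mul_comm _ (stepDenom a n)⁻¹, graphExpect_const_mul]
    · simp only [div_eq_mul_inv, mul_comm _ (stepDenom a n)⁻¹, graphExpect_const_mul]
  · split_ifs
    · rw [graphExpect_const ha]
    · simp only [div_eq_mul_inv, mul_comm _ (stepDenom a n)⁻¹, graphExpect_const_mul]

/-! ### Bounded errors for the expected counts -/

theorem limitDegree_tail_le {a : ℝ} (ha : 0 < a) (j : ℕ) {x : ℝ} (hx : x ≤ j + 2 * a + 1) :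
    limitDegree a j * (x / (a + 1)) ≤ 2 * limitConst a / (j + a) := by
  have h1 := limitDegree_le ha j
  have hp := limitDegree_pos ha j
  have hj : 0 < (j : ℝ) + a := by positivity
  rw [le_div_iff₀ hj]
  calc limitDegree a j * (x / (a + 1)) * (j + a)
      ≤ limitDegree a j * (2 * (j + a + 1)) * (j + a) := by
        gcongr
        rw [div_le_iff₀ (by positivity)]
        have hj0 : (0 : ℝ) ≤ j := j.cast_nonneg
        nlinarith
    _ = 2 * (limitDegree a j * ((j + a) * (j + a + 1))) := by ring
    _ ≤ _ := by linarith

/-- The expected in-degree distribution of the vertices without loops. -/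
theorem graphExpect_treeCount_error {a : ℝ} (ha : 0 < a) {M : ℕ}
    (hM : 1 + a ≤ ((M : ℝ) - 1) * a) :
    ∃ C : ℝ, 0 ≤ C ∧ ∀ n, M ≤ n → ∀ j : ℕ,
      |graphExpect a n (treeCount j) - limitDegree a j * (stepDenom a n / (a + 1))|
        ≤ C / (j + a) := by
  have hA := limitConst_pos ha
  have hDM := stepDenom_pos ha M
  -- The summands cover, in order, the error in the source, the tail of the limit law, and the count
  -- and the limit at time `M`.
  set C := a + 2 * limitConst a + M * (M + a) + limitConst a * stepDenom a M with hC
  have hC0 : 0 ≤ C := by positivity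
  refine ⟨C, hC0, fun n hn j => degree_error_le (α := a) (M := M)
    (E := fun n j => graphExpect a n (treeCount j) - limitDegree a j * (stepDenom a n / (a + 1)))
    ha ha ?_ ?_ ?_ hn j⟩
  · intro j
    have hj : 0 < (j : ℝ) + a := by positivity
    have hp := limitDegree_pos ha j
    have h0 : 0 ≤ graphExpect a M (treeCount j) := graphExpect_nonneg ha (treeCount_nonneg j)
    have h1 : graphExpect a M (treeCount j) ≤ M * (M + a) / (j + a) := by
      rcases lt_or_ge M j with h | h
      · rw [graphExpect_zero ha fun f _ => treeCount_eq_zero h f]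
        positivity
      · calc _ ≤ (M : ℝ) := by
              rw [← graphExpect_const ha M (M : ℝ)]
              exact graphExpect_mono ha fun f _ => treeCount_le j f
          _ ≤ _ := by
            rw [le_div_iff₀ hj]
            have : (j : ℝ) ≤ M := by exact_mod_cast h
            gcongr
    have h2 : limitDegree a j * (stepDenom a M / (a + 1)) ≤ limitConst a * stepDenom a M / (j + a) := by
      rw [le_div_iff₀ hj]
      have h3 := limitDegree_le ha j
      calc limitDegree a j * (stepDenom a M / (a + 1)) * (j + a)
          ≤ limitDegree a j * stepDenom a M * (j + a) := by
            gcongr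
            exact div_le_self hDM.le (by linarith)
        _ = limitDegree a j * (j + a) * 1 * stepDenom a M := by ring
        _ ≤ limitDegree a j * (j + a) * (j + a + 1) * stepDenom a M := by
          gcongr
          linarith
        _ = limitDegree a j * ((j + a) * (j + a + 1)) * stepDenom a M := by ring
        _ ≤ _ := by gcongr
    have h4 : 0 ≤ limitDegree a j * (stepDenom a M / (a + 1)) := by positivity
    have h5 : C / (j + a) = (a + 2 * limitConst a) / (j + a) + M * (M + a) / (j + a)
        + limitConst a * stepDenom a M / (j + a) := by rw [hC]; ring
    have h6 : 0 ≤ (a + 2 * limitConst a) / ((j : ℝ) + a) := by positivity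
    have h7 : 0 ≤ M * (M + a) / ((j : ℝ) + a) := by positivity
    have h8 : 0 ≤ limitConst a * stepDenom a M / ((j : ℝ) + a) := by positivity
    rw [abs_le]
    constructor <;> linarith
  · intro n hn j h
    have hj : 0 < (j : ℝ) + a := by positivity
    have han := mul_natCast_ge ha hM hn
    have hz : n + 1 < j := by
      rw [stepDenom_eq] at h
      have : ((n + 1 : ℕ) : ℝ) < j := by push_cast; linarith
      exact_mod_cast this
    have hp := limitDegree_pos ha j
    have hD := stepDenom_pos ha (n + 1)
    have h1 : 0 ≤ limitDegree a j * (stepDenom a (n + 1) / (a + 1)) := by positivity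
    rw [graphExpect_zero ha fun f _ => treeCount_eq_zero hz f, zero_sub, abs_neg, abs_of_nonneg h1]
    refine (limitDegree_tail_le ha j (by rw [stepDenom_succ]; linarith)).trans ?_
    gcongr
    rw [hC]
    have : 0 ≤ limitConst a * stepDenom a M := by positivity
    have : 0 ≤ (M : ℝ) * (M + a) := by positivity
    linarith
  · intro n hn j h
    have hD := stepDenom_pos ha n
    have hc : 0 ≤ 1 - (j + a) / stepDenom a n := by
      rw [sub_nonneg, div_le_one hD]; exact h
    -- The limit times `stepDenom a n / (a + 1)` solves the recursion exactly, except that a new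
    -- vertex is a loop with probability `a / stepDenom a n`; hence the source `-a`.
    have e : graphExpect a (n + 1) (treeCount j)
          - limitDegree a j * (stepDenom a (n + 1) / (a + 1))
        = (1 - (j + a) / stepDenom a n) * (graphExpect a n (treeCount j)
            - limitDegree a j * (stepDenom a n / (a + 1)))
          + (if j = 0 then -a else (j - 1 + a) * (graphExpect a n (treeCount (j - 1))
            - limitDegree a (j - 1) * (stepDenom a n / (a + 1)))) / stepDenom a n := by
      rw [graphExpect_treeCount_succ ha, stepDenom_succ]
      cases j with
      | zero =>
        have h1 := limitDegree_zero ha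
        simp only [if_true, Nat.cast_zero]
        field_simp
        linear_combination stepDenom a n * (-1) * h1
      | succ j =>
        have h1 := limitDegree_succ ha j
        simp only [Nat.add_eq_zero_iff, one_ne_zero, and_false, if_false, Nat.add_sub_cancel]
        push_cast
        field_simp
        linear_combination stepDenom a n * (-1) * h1
    rw [e]
    refine (abs_add_le _ _).trans ?_
    rw [abs_mul, abs_of_nonneg hc, abs_div, abs_of_pos hD]
    gcongr
    split_ifs with hj
    · rw [abs_neg, abs_of_pos ha, hC]
      have : 0 ≤ limitConst a * stepDenom a M := by positivity
      have : 0 ≤ (M : ℝ) * (M + a) := by positivity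
      linarith
    · have hj1 : (1 : ℝ) ≤ j := by exact_mod_cast Nat.one_le_iff_ne_zero.2 hj
      rw [abs_mul, abs_of_nonneg (show (0 : ℝ) ≤ j - 1 + a by linarith)]

/-- The expected number of vertices with a loop and given in-degree. -/
theorem graphExpect_loopCount_le {a : ℝ} (ha : 0 < a) {M : ℕ}
    (hM : 1 + a ≤ ((M : ℝ) - 1) * a) :
    ∃ C : ℝ, 0 ≤ C ∧ ∀ n, M ≤ n → ∀ j : ℕ,
      graphExpect a n (loopCount j) ≤ C / (j + (a + 1)) := by
  set C := a + M * (M + (a + 1)) with hC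
  have hC0 : 0 ≤ C := by positivity
  have hnn : ∀ n j, 0 ≤ graphExpect a n (loopCount j) := fun n j =>
    graphExpect_nonneg ha (loopCount_nonneg j)
  refine ⟨C, hC0, fun n hn j => (le_abs_self _).trans (degree_error_le (α := a + 1) (M := M)
    (E := fun n j => graphExpect a n (loopCount j)) ha (by positivity) ?_ ?_ ?_ hn j)⟩
  · intro j
    have hj : 0 < (j : ℝ) + (a + 1) := by positivity
    rw [abs_of_nonneg (hnn M j)]
    rcases lt_or_ge M (j + 1) with h | h
    · rw [graphExpect_zero ha fun f _ => loopCount_eq_zero h f]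
      positivity
    · calc _ ≤ (M : ℝ) := by
            rw [← graphExpect_const ha M (M : ℝ)]
            exact graphExpect_mono ha fun f _ => loopCount_le j f
        _ ≤ M * (M + (a + 1)) / (j + (a + 1)) := by
          rw [le_div_iff₀ hj]
          have : (j : ℝ) ≤ M := by exact_mod_cast (show j ≤ M by omega)
          gcongr
        _ ≤ _ := by
          gcongr
          linarith
  · intro n hn j h
    have han := mul_natCast_ge ha hM hn
    have hz : n + 1 < j + 1 := by
      rw [stepDenom_eq] at h
      have : (n : ℝ) < j := by linarith
      have : n < j := by exact_mod_cast this
      omega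
    rw [graphExpect_zero ha fun f _ => loopCount_eq_zero hz f, abs_zero]
    positivity
  · intro n hn j h
    have hD := stepDenom_pos ha n
    rw [abs_of_nonneg (hnn (n + 1) j), abs_of_nonneg (hnn n j), abs_of_nonneg (hnn n (j - 1)),
      graphExpect_loopCount_succ ha]
    gcongr
    split_ifs
    · rw [hC]
      have : 0 ≤ (M : ℝ) * (M + (a + 1)) := by positivity
      linarith
    · exact le_rfl

theorem profileBirth_eq_zero {a : ℝ} (ha : 0 < a) {M n : ℕ} (hM : 1 + a ≤ ((M : ℝ) - 1) * a)
    (hn : M ≤ n) {τ : VertexKind} {k : ℕ}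
    (hw : stepDenom a n < τ.ownBase a + (k + τ.neighborBase a)) (f : EdgeMap n) :
    profileBirth a τ k f = 0 := by
  have han := mul_natCast_ge ha hM hn
  rw [stepDenom_eq] at hw
  have hn0 : (0 : ℝ) ≤ n := n.cast_nonneg
  cases τ with
  | loop =>
    simp only [profileBirth, VertexKind.ownBase, VertexKind.neighborBase] at *
    rw [if_neg]
    rintro rfl
    rw [Nat.cast_zero] at hw
    linarith
  | nearLoop =>
    simp only [profileBirth, VertexKind.ownBase, VertexKind.neighborBase] at *
    split_ifs with hk
    · rfl
    · have : (n : ℝ) < k := by linarith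
      have : n < k := by exact_mod_cast this
      rw [loopCount_eq_zero (by omega), mul_zero]
  | plain =>
    simp only [profileBirth, VertexKind.ownBase, VertexKind.neighborBase] at *
    split_ifs with hk
    · rfl
    · have : ((n + 1 : ℕ) : ℝ) < k := by push_cast; linarith
      have : n + 1 < k := by exact_mod_cast this
      rw [treeCount_eq_zero (by omega), mul_zero]

/-- When the exit rate exceeds the normalizing factor, the state, its predecessors and its births
are all empty at time `n`. This covers the range where the coefficient in the recursion would be
negative. -/
theorem graphExpect_profileCount_eq_zero {a : ℝ} (ha : 0 < a) {M n : ℕ}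
    (hM : 1 + a ≤ ((M : ℝ) - 1) * a) (hn : M ≤ n) {τ : VertexKind} {l k : ℕ}
    (hw : stepDenom a n < l + τ.ownBase a + (k + τ.neighborBase a + a * l)) :
    graphExpect a (n + 1) (profileCount M τ l k) = 0 := by
  rw [graphExpect_profileCount_succ ha hn,
    graphExpect_zero ha fun f hf => hf.profileCount_eq_zero ha hM (by linarith)]
  have h1 : (if l = 0 then graphExpect a n (profileBirth a τ k)
      else (l - 1 + τ.ownBase a) * graphExpect a n (profileCount M τ (l - 1) k)) = 0 := by
    split_ifs with hl
    · subst hl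
      refine graphExpect_zero ha fun f _ => profileBirth_eq_zero ha hM hn ?_ f
      rw [Nat.cast_zero] at hw
      linarith
    · rw [graphExpect_zero ha fun f hf => hf.profileCount_eq_zero ha hM ?_, mul_zero]
      rw [Nat.cast_sub (by omega), Nat.cast_one]
      linarith
  have h2 : (if k = 0 then 0 else (k - 1 + τ.neighborBase a + a * l)
      * graphExpect a n (profileCount M τ l (k - 1))) = 0 := by
    split_ifs with hk
    · rfl
    · rw [graphExpect_zero ha fun f hf => hf.profileCount_eq_zero ha hM ?_, mul_zero]
      rw [Nat.cast_sub (by omega), Nat.cast_one]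
      linarith
  rw [h1, h2]
  simp

/-- A vertex without a loop sees at least the edge added with its parent, so neither births nor
transitions ever reach second degree zero. -/
theorem graphExpect_profileCount_zero_right {a : ℝ} (ha : 0 < a) {M : ℕ} {τ : VertexKind}
    (hτ : τ ≠ .loop) {n : ℕ} (hn : M ≤ n) (l : ℕ) :
    graphExpect a n (profileCount M τ l 0) = 0 := by
  induction n, hn using Nat.le_induction generalizing l with
  | base => exact graphExpect_zero ha fun f _ => profileCount_eq_zero_of_le le_rfl τ l 0 f
  | succ n hn ih =>
    have hb : graphExpect a n (profileBirth a τ 0) = 0 :=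
      graphExpect_zero ha fun f _ => by cases τ <;> simp [profileBirth] at hτ ⊢
    rw [graphExpect_profileCount_succ ha hn, ih, ih, hb]
    simp

theorem profileCount_loop_le (M l k : ℕ) {n : ℕ} (f : EdgeMap n) :
    profileCount M .loop l k f ≤ loopCount l f := by
  refine Finset.sum_le_sum fun t _ => ?_
  by_cases h : M ≤ (t : ℕ) ∧ f.kind t = .loop ∧ f.inDegree t = l + VertexKind.loop.offset ∧
    f.secondDegree t = k
  · rw [if_pos h, if_pos]
    refine ⟨?_, h.2.2.1⟩
    have := h.2.1
    unfold kind at this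
    split_ifs at this with h1 h2
    exact h1
  · rw [if_neg h]
    split_ifs <;> simp

/-- Loops are born at rate `a / stepDenom a n`, and children of loops at a rate proportional to the
loop counts, already bounded. Both kinds thus have a bounded source and need no limiting profile. -/
theorem graphExpect_profileCount_exceptional {a : ℝ} (ha : 0 < a) {M : ℕ}
    (hM : 1 + a ≤ ((M : ℝ) - 1) * a) {τ : VertexKind} (hτ : τ ≠ .plain) :
    ∃ K : ℝ, 0 ≤ K ∧ ∀ n, M ≤ n → ∀ l k : ℕ,
      |graphExpect a n (profileCount M τ l k)|
        ≤ K / ((l + τ.ownBase a) * (l + τ.ownBase a + 1)) := by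
  obtain ⟨C, hC, hloop⟩ := graphExpect_loopCount_le ha hM
  have hα := τ.ownBase_pos ha
  -- The first part dominates the births, the second handles loops with second degree zero and `l ≤
  -- 1 / a`.
  set K := τ.ownBase a * (a + C) + C * (1 / a + a + 2) with hK
  have hK0 : 0 ≤ K := by positivity
  have hKα : a + C ≤ K / τ.ownBase a := by
    rw [le_div_iff₀ hα, hK]
    have : 0 ≤ C * (1 / a + a + 2) := by positivity
    linarith
  have hnn : ∀ n l k, 0 ≤ graphExpect a n (profileCount M τ l k) := fun n l k =>
    graphExpect_nonneg ha (profileCount_nonneg M τ l k)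
  refine ⟨K, hK0, fun n hn l k => profile_error_le (β := τ.neighborBase a) ha hα
    (τ.neighborBase_nonneg ha) hK0
    (E := fun n l k => graphExpect a n (profileCount M τ l k)) ?_ ?_ ?_ ?_ hn l k⟩
  · intro l k
    rw [graphExpect_zero ha fun f _ => profileCount_eq_zero_of_le le_rfl τ l k f, abs_zero]
    positivity
  · intro n hn l hl
    by_cases h : τ = .loop
    · subst h
      rw [abs_of_nonneg (hnn n l 0)]
      have h1 : graphExpect a n (profileCount M .loop l 0) ≤ C / (l + (a + 1)) :=
        (graphExpect_mono ha fun f _ => profileCount_loop_le M l 0 f).trans (hloop n hn l)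
      refine h1.trans ?_
      simp only [VertexKind.ownBase] at hK ⊢
      have hl1 : (l : ℝ) ≤ 1 / a := by
        rw [le_div_iff₀ ha]
        linarith
      rw [← div_div, div_right_comm]
      gcongr
      rw [le_div_iff₀ (by positivity), hK]
      have : 0 ≤ (a + 1) * (a + C) := by positivity
      have : C * (l + (a + 1) + 1) ≤ C * (1 / a + a + 2) := by
        gcongr C * ?_
        linarith
      linarith
    · rw [graphExpect_profileCount_zero_right ha h hn, abs_zero]
      positivity
  · intro n hn l k h
    rw [graphExpect_profileCount_eq_zero ha hM hn h, abs_zero]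
    positivity
  · intro n hn l k h
    have hD := stepDenom_pos ha n
    simp only [abs_of_nonneg (hnn _ _ _)]
    rw [graphExpect_profileCount_succ ha hn]
    gcongr
    split_ifs with hl
    · refine le_trans ?_ hKα
      cases τ with
      | loop =>
        have : graphExpect a n (profileBirth a .loop k) ≤ a := by
          refine (graphExpect_mono ha (h := fun _ => a) fun f _ => ?_).trans
            (graphExpect_const ha n a).le
          simp only [profileBirth]
          split_ifs <;> linarith
        linarith
      | nearLoop =>
        by_cases hk : k = 0
        · rw [graphExpect_zero ha fun f _ => by simp [profileBirth, hk]]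
          positivity
        · rw [graphExpect_congr ha (h := fun f => (k + a) * loopCount (k - 1) f) fun f _ => by
            simp [profileBirth, hk], graphExpect_const_mul]
          have h1 := hloop n hn (k - 1)
          rw [Nat.cast_sub (by omega), Nat.cast_one, show (k : ℝ) - 1 + (a + 1) = k + a by ring,
            le_div_iff₀ (by positivity)] at h1
          linarith
      | plain => exact absurd rfl hτ
    · exact le_rfl

theorem limitProfile_le_sq {a : ℝ} (ha : 0 < a) (k l : ℕ) :
    limitProfile a k l ≤ 2 * a * limitConst a / ((l + a) * (l + a + 1)) := by
  refine le_trans ?_ (limitProfile_le ha k l)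
  refine le_mul_of_one_le_right (limitProfile_nonneg ha k l) ?_
  have : (0 : ℝ) ≤ l * (a + 1) := by positivity
  linarith [(k.cast_nonneg : (0 : ℝ) ≤ k)]

/-- The supersolution is applied to the deviation from the stationary solution; its source is the
error in the in-degree counts, bounded after multiplication by the attachment weight. -/
theorem graphExpect_profileCount_plain {a : ℝ} (ha : 0 < a) {M : ℕ}
    (hM : 1 + a ≤ ((M : ℝ) - 1) * a) :
    ∃ K : ℝ, 0 ≤ K ∧ ∀ n, M ≤ n → ∀ l k : ℕ,
      |graphExpect a n (profileCount M .plain l k)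
          - limitProfile a k l * (stepDenom a n / (a + 1))|
        ≤ K / ((l + a) * (l + a + 1)) := by
  obtain ⟨C, hC, htree⟩ := graphExpect_treeCount_error ha hM
  have hA := limitConst_pos ha
  have hDM := stepDenom_pos ha M
  set K := a * C + 2 * a * limitConst a * (stepDenom a M + 1) with hK
  have hK0 : 0 ≤ K := by positivity
  have hK1 : 2 * a * limitConst a * stepDenom a M ≤ K := by
    have : 0 ≤ 2 * a * limitConst a := by positivity
    have : 0 ≤ a * C := by positivity
    linarith
  have hK2 : 2 * a * limitConst a ≤ K := by
    have : 0 ≤ 2 * a * limitConst a * stepDenom a M := by positivity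
    have : 0 ≤ a * C := by positivity
    linarith
  have hKα : C ≤ K / a := by
    rw [le_div_iff₀ ha, hK]
    have : 0 ≤ 2 * a * limitConst a * (stepDenom a M + 1) := by positivity
    linarith
  refine ⟨K, hK0, fun n hn l k => profile_error_le (α := a) (β := a) ha ha ha.le hK0
    (E := fun n l k => graphExpect a n (profileCount M .plain l k)
          - limitProfile a k l * (stepDenom a n / (a + 1))) ?_ ?_ ?_ ?_ hn l k⟩
  · intro l k
    have hc := limitProfile_nonneg ha k l
    rw [graphExpect_zero ha fun f _ => profileCount_eq_zero_of_le le_rfl _ l k f, zero_sub, abs_neg,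
      abs_of_nonneg (by positivity)]
    calc _ ≤ 2 * a * limitConst a / ((l + a) * (l + a + 1)) * stepDenom a M := by
          gcongr
          · exact limitProfile_le_sq ha k l
          · exact div_le_self hDM.le (by linarith)
      _ = 2 * a * limitConst a * stepDenom a M / ((l + a) * (l + a + 1)) := by ring
      _ ≤ _ := by gcongr
  · intro n hn l _
    rw [graphExpect_profileCount_zero_right ha (by simp) hn]
    simp only [limitProfile, zero_mul, sub_zero, abs_zero]
    positivity
  · intro n hn l k h
    have hc := limitProfile_nonneg ha k l
    have hD := stepDenom_pos ha (n + 1)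
    rw [graphExpect_profileCount_eq_zero ha hM hn (by
      simpa [VertexKind.ownBase, VertexKind.neighborBase] using h), zero_sub, abs_neg,
      abs_of_nonneg (by positivity)]
    -- In an empty state the deviation is the limiting count itself, and `stepDenom a (n + 1)` is at
    -- most the weight in `limitProfile_le`.
    calc _ ≤ limitProfile a k l * (l * (a + 1) + k + 1 + 3 * a) := by
          gcongr
          refine (div_le_self hD.le (by linarith)).trans ?_
          rw [stepDenom_succ]
          linarith
      _ ≤ _ := limitProfile_le ha k l
      _ ≤ _ := by gcongr
  · intro n hn l k h
    have hD := stepDenom_pos ha n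
    have hc : 0 ≤ 1 - (l + a + (k + a + a * l)) / stepDenom a n := by
      rw [sub_nonneg, div_le_one hD]; exact h
    set b : ℝ := if k = 0 then 0 else (k - 1 + a) * (graphExpect a n (treeCount (k - 1))
      - limitDegree a (k - 1) * (stepDenom a n / (a + 1))) with hb
    -- Births split into the stationary rate and a bounded error `b`; the former cancels against the
    -- profile.
    have hbirth : graphExpect a n (profileBirth a .plain k)
        = b + if k = 0 then 0 else birthRate a (k - 1) * (stepDenom a n / (a + 1)) := by
      by_cases hk : k = 0
      · rw [hb, if_pos hk, if_pos hk, add_zero]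
        exact graphExpect_zero ha fun f _ => by simp [profileBirth, hk]
      · rw [hb, if_neg hk, if_neg hk, graphExpect_congr ha
          (h := fun f => (k - 1 + a) * treeCount (k - 1) f) fun f _ => by simp [profileBirth, hk],
          graphExpect_const_mul, birthRate, Nat.cast_sub (by omega), Nat.cast_one]
        ring
    have hbC : |b| ≤ K / a := by
      refine le_trans ?_ hKα
      rw [hb]
      split_ifs with hk
      · simpa using hC
      · have hk1 : (1 : ℝ) ≤ k := by exact_mod_cast Nat.one_le_iff_ne_zero.2 hk
        have h1 := htree n hn (k - 1)
        rw [Nat.cast_sub (by omega), Nat.cast_one, le_div_iff₀ (by linarith)] at h1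
        rw [abs_mul, abs_of_nonneg (show (0 : ℝ) ≤ k - 1 + a by linarith)]
        linarith
    have e : graphExpect a (n + 1) (profileCount M .plain l k)
          - limitProfile a k l * (stepDenom a (n + 1) / (a + 1))
        = (1 - (l + a + (k + a + a * l)) / stepDenom a n)
            * (graphExpect a n (profileCount M .plain l k)
              - limitProfile a k l * (stepDenom a n / (a + 1)))
          + (if l = 0 then b else (l - 1 + a)
            * (graphExpect a n (profileCount M .plain (l - 1) k)
              - limitProfile a k (l - 1) * (stepDenom a n / (a + 1)))) / stepDenom a n
          + (if k = 0 then 0 else (k - 1 + a + a * l)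
            * (graphExpect a n (profileCount M .plain l (k - 1))
              - limitProfile a (k - 1) l * (stepDenom a n / (a + 1)))) / stepDenom a n := by
      rw [graphExpect_profileCount_succ ha hn, stepDenom_succ, hbirth]
      simp only [VertexKind.ownBase, VertexKind.neighborBase]
      cases k with
      | zero =>
        simp only [if_true, limitProfile, zero_mul, sub_zero, add_zero]
      | succ k =>
        simp only [Nat.add_eq_zero_iff, one_ne_zero, and_false, if_false, Nat.add_sub_cancel]
        cases l with
        | zero =>
          have h1 := limitProfile_succ_zero ha k
          simp only [if_true, Nat.cast_zero]
          push_cast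
          field_simp
          linear_combination stepDenom a n * (-1) * h1
        | succ l =>
          have h1 := limitProfile_succ_succ ha k l
          simp only [Nat.add_eq_zero_iff, one_ne_zero, and_false, if_false, Nat.add_sub_cancel]
          push_cast
          field_simp
          linear_combination stepDenom a n * (-1) * h1
    rw [e]
    refine (abs_add_three _ _ _).trans ?_
    rw [abs_mul, abs_of_nonneg hc, abs_div, abs_of_pos hD, abs_div, abs_of_pos hD]
    gcongr
    · split_ifs with hl
      · exact hbC
      · have hl1 : (1 : ℝ) ≤ l := by exact_mod_cast Nat.one_le_iff_ne_zero.2 hl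
        rw [abs_mul, abs_of_nonneg (show (0 : ℝ) ≤ l - 1 + a by linarith)]
    · split_ifs with hk
      · simp
      · have hk1 : (1 : ℝ) ≤ k := by exact_mod_cast Nat.one_le_iff_ne_zero.2 hk
        have : 0 ≤ a * (l : ℝ) := by positivity
        rw [abs_mul, abs_of_nonneg (show (0 : ℝ) ≤ k - 1 + a + a * l by linarith)]

/-! ### Assembly of the estimate -/

/-- Up to the first `M` vertices, the vertices with second degree `k` are split according to their
kind and their number of children. -/
theorem countSecondDegree_sub_le {n : ℕ} (M L k : ℕ) (hL : n < L) (f : EdgeMap n) :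
    |(f.countSecondDegree k : ℝ) - ∑ l ∈ Finset.range L,
      (profileCount M .plain l k f + profileCount M .nearLoop l k f
        + profileCount M .loop l k f)| ≤ M := by
  classical
  have h1 : (f.countSecondDegree k : ℝ) = ∑ t : Fin n, if f.secondDegree t = k then 1 else 0 := by
    rw [countSecondDegree, Finset.card_filter]
    push_cast
    rfl
  have h2 : ∑ l ∈ Finset.range L, (profileCount M .plain l k f + profileCount M .nearLoop l k f
        + profileCount M .loop l k f)
      = ∑ t : Fin n, if M ≤ (t : ℕ) ∧ f.secondDegree t = k then 1 else 0 := by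
    simp only [profileCount, ← Finset.sum_add_distrib]
    rw [Finset.sum_comm]
    refine Finset.sum_congr rfl fun t _ => ?_
    have hd := f.inDegree_le t
    have ho := offset_kind_le_inDegree f t
    -- A vertex contributes for exactly one kind and one value of `l`.
    have e : ∀ l, ((if M ≤ (t : ℕ) ∧ f.kind t = .plain ∧
          f.inDegree t = l + VertexKind.plain.offset ∧ f.secondDegree t = k then (1 : ℝ) else 0)
        + (if M ≤ (t : ℕ) ∧ f.kind t = .nearLoop ∧
          f.inDegree t = l + VertexKind.nearLoop.offset ∧ f.secondDegree t = k then 1 else 0))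
        + (if M ≤ (t : ℕ) ∧ f.kind t = .loop ∧
          f.inDegree t = l + VertexKind.loop.offset ∧ f.secondDegree t = k then 1 else 0)
        = if f.inDegree t - (f.kind t).offset = l then
            (if M ≤ (t : ℕ) ∧ f.secondDegree t = k then 1 else 0) else 0 := by
      intro l
      have hiff : f.inDegree t = l + (f.kind t).offset ↔ f.inDegree t - (f.kind t).offset = l := by
        omega
      rw [← ite_and]
      cases hkind : f.kind t <;> rw [hkind] at hiff <;> simp [← hiff, and_comm, and_left_comm, and_assoc]
    rw [Finset.sum_congr rfl fun l _ => e l, Finset.sum_ite_eq, if_pos]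
    rw [Finset.mem_range]
    omega
  rw [h1, h2, ← Finset.sum_sub_distrib]
  calc _ ≤ ∑ t : Fin n, if (t : ℕ) < M then (1 : ℝ) else 0 := by
        refine (Finset.abs_sum_le_sum_abs _ _).trans (Finset.sum_le_sum fun t _ => ?_)
        by_cases h : M ≤ (t : ℕ)
        · simp [h, not_lt.2 h]
        · rw [if_pos (show (t : ℕ) < M by omega)]
          split_ifs <;> simp
    _ = ∑ t ∈ Finset.range n, if t < M then (1 : ℝ) else 0 :=
        Fin.sum_univ_eq_sum_range (fun i => if i < M then (1 : ℝ) else 0) n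
    _ = ((Finset.range n).filter (· < M)).card := by rw [Finset.sum_boole]
    _ ≤ M := by
      have : (Finset.range n).filter (· < M) ⊆ Finset.range M := fun i hi => by
        simpa using (Finset.mem_filter.1 hi).2
      exact_mod_cast (Finset.card_le_card this).trans (Finset.card_range M).le

theorem limitSecond_le {a : ℝ} (ha : 0 < a) (k : ℕ) : limitSecond a k ≤ 2 * limitConst a := by
  have hA := limitConst_pos ha
  refine (summable_limitProfile ha k).tsum_le_of_sum_range_le fun L => ?_
  calc _ ≤ ∑ l ∈ Finset.range L, 2 * a * limitConst a * (1 / (((l : ℝ) + a) * (l + a + 1))) :=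
        Finset.sum_le_sum fun l _ => (limitProfile_le_sq ha k l).trans (le_of_eq (by ring))
    _ ≤ 2 * a * limitConst a * (1 / a) := by
      rw [← Finset.mul_sum]
      gcongr
      exact sum_inv_mul_le ha L
    _ = _ := by field_simp

/-- The expected number of vertices with second degree `k` is linear in `n`, up to a bounded
error. -/
theorem expectedCount_sub_le {a : ℝ} (ha : 0 < a) :
    ∃ C : ℝ, 0 ≤ C ∧ ∀ n k : ℕ, |expectedCount ha n k - n * limitSecond a k| ≤ C := by
  have hA := limitConst_pos ha
  -- The number of initial vertices to discard so that later ones leave enough room; they change the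
  -- count by at most `M`.
  obtain ⟨M, hM⟩ : ∃ M : ℕ, 1 + a ≤ ((M : ℝ) - 1) * a := by
    obtain ⟨M, h⟩ := exists_nat_ge ((1 + a) / a + 1)
    refine ⟨M, ?_⟩
    rw [← div_le_iff₀ ha]
    linarith
  obtain ⟨K1, hK1, h1⟩ := graphExpect_profileCount_plain ha hM
  obtain ⟨K2, hK2, h2⟩ := graphExpect_profileCount_exceptional ha hM (τ := .nearLoop) (by simp)
  obtain ⟨K3, hK3, h3⟩ := graphExpect_profileCount_exceptional ha hM (τ := .loop) (by simp)
  simp only [VertexKind.ownBase] at h2 h3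
  have hlim0 : ∀ k, 0 ≤ limitSecond a k := limitSecond_nonneg ha
  refine ⟨M + (K1 + K2) * (1 / a) + K3 * (1 / (a + 1)) + 2 * limitConst a * (M + 1),
    by positivity, fun n k => ?_⟩
  have hrest : 0 ≤ (K1 + K2) * (1 / a) + K3 * (1 / (a + 1)) := by positivity
  rw [expectedCount, integral_law_eq ha]
  rcases lt_or_ge n M with hn | hn
  · have hnM : (n : ℝ) ≤ M := by exact_mod_cast hn.le
    have hle : graphExpect a n (fun f => (f.countSecondDegree k : ℝ)) ≤ n := by
      refine (graphExpect_mono ha (h := fun _ => (n : ℝ)) fun f _ => ?_).trans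
        (graphExpect_const ha n _).le
      have := Finset.card_filter_le (Finset.univ : Finset (Fin n)) fun t => f.secondDegree t = k
      rw [Finset.card_univ, Fintype.card_fin] at this
      exact_mod_cast this
    have hge : 0 ≤ graphExpect a n (fun f => (f.countSecondDegree k : ℝ)) :=
      graphExpect_nonneg ha fun f => Nat.cast_nonneg _
    have hc : n * limitSecond a k ≤ (M + 1) * (2 * limitConst a) :=
      mul_le_mul (by linarith) (limitSecond_le ha k) (hlim0 k) (by positivity)
    have hc0 : 0 ≤ n * limitSecond a k := mul_nonneg n.cast_nonneg (hlim0 k)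
    have : 0 ≤ 2 * limitConst a * (M + 1) := by positivity
    rw [abs_le]
    constructor <;> linarith
  · have hD := stepDenom_pos ha n
    have hsum : ∀ L, n < L → |graphExpect a n (fun f => (f.countSecondDegree k : ℝ))
        - (∑ l ∈ Finset.range L, limitProfile a k l) * (stepDenom a n / (a + 1))|
          ≤ M + (K1 + K2) * (1 / a) + K3 * (1 / (a + 1)) := by
      intro L hL
      set S := ∑ l ∈ Finset.range L, (graphExpect a n (profileCount M .plain l k)
        + graphExpect a n (profileCount M .nearLoop l k)
        + graphExpect a n (profileCount M .loop l k)) with hS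
      have hSe : graphExpect a n (fun f => ∑ l ∈ Finset.range L,
          (profileCount M .plain l k f + profileCount M .nearLoop l k f
            + profileCount M .loop l k f)) = S := by
        rw [graphExpect_sum]
        refine Finset.sum_congr rfl fun l _ => ?_
        rw [graphExpect_add, graphExpect_add]
      have hA1 : |graphExpect a n (fun f => (f.countSecondDegree k : ℝ)) - S| ≤ M := by
        rw [← hSe, abs_le]
        constructor
        · have := graphExpect_mono ha (n := n) (g := fun f => ∑ l ∈ Finset.range L,
            (profileCount M .plain l k f + profileCount M .nearLoop l k f
              + profileCount M .loop l k f)) (h := fun f => (f.countSecondDegree k : ℝ) + M)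
            fun f _ => by linarith [(abs_le.1 (countSecondDegree_sub_le M L k hL f)).1]
          rw [graphExpect_add, graphExpect_const ha] at this
          linarith
        · have := graphExpect_mono ha (n := n) (g := fun f => (f.countSecondDegree k : ℝ))
            (h := fun f => (∑ l ∈ Finset.range L,
            (profileCount M .plain l k f + profileCount M .nearLoop l k f
              + profileCount M .loop l k f)) + M)
            fun f _ => by linarith [(abs_le.1 (countSecondDegree_sub_le M L k hL f)).2]
          rw [graphExpect_add, graphExpect_const ha] at this
          linarith
      have hA2 : |S - (∑ l ∈ Finset.range L, limitProfile a k l) * (stepDenom a n / (a + 1))|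
          ≤ (K1 + K2) * (1 / a) + K3 * (1 / (a + 1)) := by
        rw [hS, Finset.sum_mul, ← Finset.sum_sub_distrib]
        calc _ ≤ ∑ l ∈ Finset.range L, ((K1 + K2) * (1 / (((l : ℝ) + a) * (l + a + 1)))
              + K3 * (1 / (((l : ℝ) + (a + 1)) * (l + (a + 1) + 1)))) := by
              refine (Finset.abs_sum_le_sum_abs _ _).trans (Finset.sum_le_sum fun l _ => ?_)
              have b1 := h1 n hn l k
              have b2 := h2 n hn l k
              have b3 := h3 n hn l k
              rw [div_eq_mul_one_div K1] at b1
              rw [div_eq_mul_one_div K2] at b2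
              rw [div_eq_mul_one_div K3] at b3
              rw [abs_le] at *
              constructor <;> linarith [b1.1, b1.2, b2.1, b2.2, b3.1, b3.2]
          _ ≤ _ := by
            rw [Finset.sum_add_distrib, ← Finset.mul_sum, ← Finset.mul_sum]
            gcongr
            · exact sum_inv_mul_le ha L
            · exact sum_inv_mul_le (by positivity) L
      rw [abs_le] at *
      constructor <;> linarith [hA1.1, hA1.2, hA2.1, hA2.2]
    -- For `L > n` the truncation loses no vertex and the bound does not depend on `L`, so only the
    -- partial sum of the profile changes in the limit.
    have hlim : |graphExpect a n (fun f => (f.countSecondDegree k : ℝ))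
        - limitSecond a k * (stepDenom a n / (a + 1))|
          ≤ M + (K1 + K2) * (1 / a) + K3 * (1 / (a + 1)) := by
      refine le_of_tendsto (((((summable_limitProfile ha k).hasSum.tendsto_sum_nat).mul_const
        (stepDenom a n / (a + 1))).const_sub _).abs) ?_
      filter_upwards [eventually_gt_atTop n] with L hL using hsum L hL
    -- The factor `stepDenom a n / (a + 1)` equals `n + a / (a + 1)`, a bounded shift.
    have hshift : limitSecond a k * (stepDenom a n / (a + 1))
        = n * limitSecond a k + limitSecond a k * (a / (a + 1)) := by
      rw [stepDenom_eq]
      field_simp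
    have hs1 : limitSecond a k * (a / (a + 1)) ≤ 2 * limitConst a * (M + 1) := by
      refine mul_le_mul (limitSecond_le ha k) ?_ (by positivity) (by positivity)
      refine ((div_le_one (by positivity)).2 (by linarith)).trans ?_
      linarith [(M.cast_nonneg : (0 : ℝ) ≤ M)]
    have hs0 : 0 ≤ limitSecond a k * (a / (a + 1)) := mul_nonneg (hlim0 k) (by positivity)
    rw [hshift] at hlim
    rw [abs_le] at *
    constructor <;> linarith [hlim.1, hlim.2]

theorem theorem3 (a : ℝ) (ha : 0 < a) :
    ∃ C : ℝ, 0 < C ∧ ∀ n k : ℕ, 1 ≤ n → 1 ≤ k → ∃ ε₁ ε₂ : ℝ,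
      |ε₁| ≤ C * (Real.log (max (k : ℝ) 2) ^ ⌈a + 1⌉₊ / (k : ℝ)) ∧
      |ε₂| ≤ C * ((k : ℝ) ^ (1 + a) / (n : ℝ)) ∧
      BuckleyOsthus.expectedCount ha n k =
        (a + 1) * Real.Gamma (2 * a + 1) * (n : ℝ) / (Real.Gamma a * (k : ℝ) ^ (a + 1))
          * (1 + ε₁ + ε₂) := by
  obtain ⟨C1, hC1, h1⟩ := limitSecond_asymptotic ha
  obtain ⟨C2, hC2, h2⟩ := expectedCount_sub_le ha
  have hA := limitConst_pos ha
  -- The first error is the relative error of the limiting law, the second the rescaled deviation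
  -- from `n * limitSecond a k`; the summand 1 only makes the constant positive.
  refine ⟨C1 + C2 / limitConst a + 1, by positivity, fun n k hn hk =>
    ⟨limitSecond a k * (k : ℝ) ^ (a + 1) / limitConst a - 1,
      (expectedCount ha n k - n * limitSecond a k) * (k : ℝ) ^ (a + 1) / (limitConst a * n),
      ?_, ?_, ?_⟩⟩
  · refine (h1 k hk).trans ?_
    rw [Nat.ceil_add_one ha.le]
    have hl : 0 < posLog k := by linarith [half_le_posLog k]
    change _ ≤ _ * (posLog k ^ (⌈a⌉₊ + 1) / k)
    gcongr
    have : 0 ≤ C2 / limitConst a := by positivity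
    linarith
  · have hn0 : (0 : ℝ) < n := by exact_mod_cast hn
    have hk0 : (0 : ℝ) < k := by exact_mod_cast hk
    rw [abs_div, abs_mul, abs_of_pos (show 0 < (k : ℝ) ^ (a + 1) by positivity),
      abs_of_pos (show 0 < limitConst a * n by positivity), add_comm 1 a]
    calc _ ≤ C2 * (k : ℝ) ^ (a + 1) / (limitConst a * n) := by
          gcongr
          exact h2 n k
      _ = C2 / limitConst a * ((k : ℝ) ^ (a + 1) / n) := by field_simp
      _ ≤ _ := by
        gcongr
        linarith
  · have hn0 : (0 : ℝ) < n := by exact_mod_cast hn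
    have hk0 : (0 : ℝ) < (k : ℝ) ^ (a + 1) := by
      have : (0 : ℝ) < k := by exact_mod_cast hk
      positivity
    have e : (a + 1) * Real.Gamma (2 * a + 1) * (n : ℝ) / (Real.Gamma a * (k : ℝ) ^ (a + 1))
        = limitConst a * n / (k : ℝ) ^ (a + 1) := by
      rw [limitConst, div_mul_eq_mul_div, div_div]
    rw [e]
    field_simp
    ring
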